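/- An instance $(\mathcal I,D)$ of Demand Strip Packing consists of a deadline $D\in\mathbb N$ and a finite set $\mathcal I$ of items, each item $i$ having a width $w(i)\in\mathbb N$ with $0<w(i)\le D$ and a height $h(i)\in\mathbb N_{>0}$. A $D$-feasible packing is a map $\sigma:\mathcal I\to\mathbb R$ with $0\le\sigma(i)\le D-w(i)$ for all $i$; item $i$ is packed at $t$ if $\sigma(i)\le t<\sigma(i)+w(i)$, and the height of $\sigma$ is the maximum over $t\in[0,D]$ of the total height of the items packed at $t$. An optimal packing is a $D$-feasible packing of minimum height, and this height is denoted by $\mathrm{Opt}$. An item is tall if $h(i)>\mathrm{Opt}/2$. The gaps of an optimal packing are the maximal non-empty right-open segments $[\ell,r)\subseteq[0,D]$ in which no tall item is packed; the width of $[\ell,r)$ is $r-\ell$. An $(\varepsilon,\mathrm{Opt})$-neat packing is a $D$-feasible packing of $\mathcal I$ of height at most $(\frac32+\varepsilon)\,\mathrm{Opt}$ in which all tall items are packed in immediate succession in non-increasing order of height, starting at $0$. Let $\varepsilon>0$, let $\lambda\le\min\bigl\{\frac{\varepsilon}{3(5+4\varepsilon)},\frac1{60}\bigr\}$, and let $\sigma^*$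 be an optimal packing of $(\mathcal I,D)$ with a gap $[\ell,r)$ such that 1. $r-\ell\ge(\frac12-3\lambda)D$, 2. the gaps to the left of $\ell$ have a combined width of at most $\lambda D$, and 3. the gaps to the right of $r$ have a combined width of at most $\lambda D$. Then $(\mathcal I,D)$ admits an $(\varepsilon,\mathrm{Opt})$-neat packing. -/

import Mathlib

namespace DSP

/-- An instance of Demand Strip Packing: a deadline `D` and finitely many items (indexed by `ι`)
with positive integral widths, at most `D`, and positive integral heights. -/
structure Instance (ι : Type*) where
  D : ℕ
  w : ι → ℕ
  h : ι → ℕ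
  w_pos : ∀ i, 0 < w i
  w_le : ∀ i, w i ≤ D
  h_pos : ∀ i, 0 < h i

section

variable {ι : Type*} [Fintype ι]

/-- A packing assigns a (real) starting point to every item. It is `D`-feasible if no item starts
before `0` and no item ends after `D`. -/
def Feasible (I : Instance ι) (σ : ι → ℝ) : Prop :=
  ∀ i, 0 ≤ σ i ∧ σ i ≤ (I.D : ℝ) - I.w i

/-- Item `i` is packed at time point `t`. -/
def PackedAt (I : Instance ι) (σ : ι → ℝ) (i : ι) (t : ℝ) : Prop :=
  σ i ≤ t ∧ t < σ i + I.w i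

open Classical in
/-- The packing height at `t`: the total height of the items packed at `t`. -/
noncomputable def heightAt (I : Instance ι) (σ : ι → ℝ) (t : ℝ) : ℕ :=
  ∑ i ∈ Finset.univ.filter (fun i => PackedAt I σ i t), I.h i

/-- The height of a packing: the maximum of the packing heights at the points of `[0, D]`. -/
noncomputable def height (I : Instance ι) (σ : ι → ℝ) : ℕ :=
  sSup (heightAt I σ '' Set.Icc (0 : ℝ) I.D)

/-- The supremum in `height` is a maximum. -/
theorem height_isGreatest (I : Instance ι) (σ : ι → ℝ) :
    IsGreatest (heightAt I σ '' Set.Icc (0 : ℝ) I.D) (height I σ) := by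
  classical
  have hne : (heightAt I σ '' Set.Icc (0 : ℝ) I.D).Nonempty :=
    ⟨_, 0, ⟨le_rfl, Nat.cast_nonneg _⟩, rfl⟩
  have hb : BddAbove (heightAt I σ '' Set.Icc (0 : ℝ) I.D) := by
    refine ⟨∑ i, I.h i, ?_⟩
    rintro _ ⟨t, -, rfl⟩
    exact Finset.sum_le_sum_of_subset (Finset.filter_subset _ _)
  exact ⟨Nat.sSup_mem hne hb, fun _ hx => le_csSup hb hx⟩

/-- An optimal packing: a feasible packing of minimum height. -/
def IsOptimal (I : Instance ι) (σ : ι → ℝ) : Prop :=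
  Feasible I σ ∧ ∀ σ' : ι → ℝ, Feasible I σ' → height I σ ≤ height I σ'

/-- The optimal height of an instance. -/
noncomputable def opt (I : Instance ι) : ℕ :=
  sInf (height I '' {σ | Feasible I σ})

theorem IsOptimal.height_eq_opt {I : Instance ι} {σ : ι → ℝ} (hσ : IsOptimal I σ) :
    height I σ = opt I := by
  refine le_antisymm (le_csInf ⟨_, σ, hσ.1, rfl⟩ ?_) (Nat.sInf_le ⟨σ, hσ.1, rfl⟩)
  rintro _ ⟨σ', h', rfl⟩
  exact hσ.2 σ' h'

/-- The `H`-tall items. -/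
def IsTall (I : Instance ι) (H : ℝ) (i : ι) : Prop := H / 2 < I.h i

/-- No `H`-tall item is packed in the segment `[l, r)`. -/
def TallFree (I : Instance ι) (H : ℝ) (σ : ι → ℝ) (l r : ℝ) : Prop :=
  ∀ i, IsTall I H i → ∀ t ∈ Set.Ico l r, ¬ PackedAt I σ i t

/-- `[l, r)` is a gap: a maximal non-empty right-open segment of `[0, D]` in which no `H`-tall item
is packed. -/
def IsGap (I : Instance ι) (H : ℝ) (σ : ι → ℝ) (l r : ℝ) : Prop :=
  0 ≤ l ∧ l < r ∧ r ≤ I.D ∧ TallFree I H σ l r ∧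
    ∀ l' r', 0 ≤ l' → l' ≤ l → r ≤ r' → r' ≤ I.D → TallFree I H σ l' r' → l' = l ∧ r' = r

/-- There are only finitely many gaps, so that the sums below are genuine finite sums. -/
theorem finite_setOf_isGap (I : Instance ι) (H : ℝ) (σ : ι → ℝ) :
    {p : ℝ × ℝ | IsGap I H σ p.1 p.2}.Finite := by
  classical
  have hfin : (insert (0 : ℝ) (Set.range fun i => σ i + (I.w i : ℝ))).Finite :=
    (Set.finite_range _).insert 0
  refine Set.Finite.of_finite_image (f := Prod.fst) (hfin.subset ?_) ?_
  · rintro _ ⟨⟨l, r⟩, ⟨h0, hlr, hrD, hfree, hmax⟩, rfl⟩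
    simp only at *
    by_contra hl
    simp only [Set.mem_insert_iff, Set.mem_range, not_or, not_exists] at hl
    have hlpos : 0 < l := lt_of_le_of_ne h0 (Ne.symm hl.1)
    let S : Finset ℝ :=
      insert 0 ((Finset.univ.image fun i => σ i + (I.w i : ℝ)).filter (· < l))
    have hS : S.Nonempty := ⟨0, Finset.mem_insert_self _ _⟩
    have hmS := S.max'_mem hS
    have h0m : 0 ≤ S.max' hS := S.le_max' 0 (Finset.mem_insert_self _ _)
    have hml : S.max' hS < l := by
      rcases Finset.mem_insert.1 hmS with h | h
      · rw [h]; exact hlpos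
      · exact (Finset.mem_filter.1 h).2
    have := (hmax (S.max' hS) r h0m hml.le le_rfl hrD ?_).1
    · exact absurd this hml.ne
    · rintro i hi t ⟨ht1, ht2⟩ ⟨hp1, hp2⟩
      by_cases htl : l ≤ t
      · exact hfree i hi t ⟨htl, ht2⟩ ⟨hp1, hp2⟩
      · push Not at htl
        rcases lt_trichotomy (σ i + (I.w i : ℝ)) l with h | h | h
        · have : σ i + (I.w i : ℝ) ≤ S.max' hS := by
            refine S.le_max' _ (Finset.mem_insert_of_mem (Finset.mem_filter.2 ⟨?_, h⟩))
            exact Finset.mem_image_of_mem _ (Finset.mem_univ i)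
          linarith
        · exact hl.2 i h
        · exact hfree i hi l ⟨le_rfl, hlr⟩ ⟨by linarith, h⟩
  · rintro ⟨l, r⟩ ⟨h0, hlr, hrD, hfree, hmax⟩ ⟨l', r'⟩ ⟨h0', hlr', hrD', hfree', hmax'⟩ hll
    simp only at *
    subst hll
    rcases le_total r r' with h | h
    · rw [(hmax l r' h0 le_rfl h hrD' hfree').2]
    · rw [(hmax' l r h0 le_rfl h hrD hfree).2]

/-- The combined width of the gaps to the left of `x`. -/
noncomputable def gapWidthLeft (I : Instance ι) (H : ℝ) (σ : ι → ℝ) (x : ℝ) : ℝ :=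
  ∑ᶠ p ∈ {p : ℝ × ℝ | IsGap I H σ p.1 p.2 ∧ p.2 ≤ x}, (p.2 - p.1)

/-- The combined width of the gaps to the right of `x`. -/
noncomputable def gapWidthRight (I : Instance ι) (H : ℝ) (σ : ι → ℝ) (x : ℝ) : ℝ :=
  ∑ᶠ p ∈ {p : ℝ × ℝ | IsGap I H σ p.1 p.2 ∧ x ≤ p.1}, (p.2 - p.1)

/-- The `H`-tall items are packed in immediate succession, in non-increasing order of height,
starting at `0`: they can be enumerated in non-increasing order of height such that each of them
starts at the total width of its predecessors, i.e. the first one at `0` and each other one at the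
end of the one before it. -/
def TallSorted (I : Instance ι) (H : ℝ) (σ : ι → ℝ) : Prop :=
  ∃ (k : ℕ) (e : Fin k ≃ {i // IsTall I H i}),
    (∀ a b : Fin k, a ≤ b → I.h (e b).1 ≤ I.h (e a).1) ∧
    ∀ a : Fin k, σ (e a).1 = ∑ b ∈ Finset.Iio a, (I.w (e b).1 : ℝ)

/-- `(ε, H)`-neat packings. -/
def IsNeat (I : Instance ι) (ε H : ℝ) (σ : ι → ℝ) : Prop :=
  Feasible I σ ∧ (height I σ : ℝ) ≤ (3 / 2 + ε) * H ∧ TallSorted I H σ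

end

end DSP

namespace DSP

set_option linter.unusedSectionVars false

/-! Write H for the optimum, gl and gr for the widths to the left of l and to the right of r in
which no tall item is packed, and d for the total width of the tall items on the right. By
reflection one may assume D - r ≤ l. The sorted tall items end by l - gl + d. The other items are
moved so that those packed at any point of the new packing split into few sets, each of which
already met in the old packing: a set that met has load at most H, and one that also met a tall item
has load at most H/2. Away from the tall items this gives 3H/2, plus εH in places.

An item to the left of l that meets tall items is delayed by the free width up to its last contact q
with one of them. Such items meet after the delay only if they already met at a contact point, next
to a tall item (`LastTouch.lt_of_shifted_lt`, `LastTouch.load_before`). The items across l, or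
across r, meet the tall item bounding the gap and weigh at most H/2 (`load_cross_l`,
`load_cross_r`). If a tall item of height x is packed at τ, then the tall items of height at least x
are wider than τ in total, so one of them met all the right-aligned, or all the shifted, items
concerned; these weigh at most H - x (`load_right_aligned`, `load_shifted`).

Loose items, which never meet a tall item, are compressed to the free width, cut into groups of
small load by first fit (`exists_coloring`), and the groups are packed side by side.

If gl ≤ d, the content of the gap moves right by d, the right side is stretched to the left, and the
loose items go to the right end (`exists_packing_of_le`). If d < gl, the sorted tall items fit to
the left of l, the gap stays in place, and the loose groups go into a window of it where few items
across l end (`exists_packing_of_lt`); the pigeonhole principle over about 1/(2ε) windows bounds the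
excess by εH. -/

/-- A packing (with real data) of items of widths `w` and heights `h` in `[0, D]` in which no more
than `H` is packed at any time, together with a segment `[l, r)` that is a gap between the items of
height greater than `H / 2`. -/
structure GapConfig {ι : Type*} (w h : ι → ℝ) (D H : ℝ) (s : ι → ℝ) (l r : ℝ) : Prop where
  w_pos : ∀ i, 0 < w i
  h_nonneg : ∀ i, 0 ≤ h i
  s_nonneg : ∀ i, 0 ≤ s i
  end_le : ∀ i, s i + w i ≤ D
  -- Pairwise meeting is equivalent to a common point for intervals on a line. Unlike a condition at
  -- points of right-open segments, it is visibly invariant under reflection.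
  load : ∀ S : Finset ι, (∀ i ∈ S, ∀ k ∈ S, s i < s k + w k) → ∑ i ∈ S, h i ≤ H
  l_nonneg : 0 ≤ l
  l_lt_r : l < r
  r_le : r ≤ D
  tall_side : ∀ i, H / 2 < h i → s i + w i ≤ l ∨ r ≤ s i
  left_tall : 0 < l → ∃ j, H / 2 < h j ∧ s j + w j = l
  right_tall : r < D → ∃ j, H / 2 < h j ∧ s j = r

open Classical in
/-- The tall items that end by `l`. -/
noncomputable def leftTall {ι : Type*} [Fintype ι] (w h : ι → ℝ) (H : ℝ) (s : ι → ℝ) (l : ℝ) :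
    Finset ι :=
  Finset.univ.filter fun j => H / 2 < h j ∧ s j + w j ≤ l

open Classical in
/-- The tall items that start at `r` or later. -/
noncomputable def rightTall {ι : Type*} [Fintype ι] (h : ι → ℝ) (H : ℝ) (s : ι → ℝ) (r : ℝ) :
    Finset ι :=
  Finset.univ.filter fun j => H / 2 < h j ∧ r ≤ s j

/-- The part of `(-∞, x)` in which no tall item that ends by `l` is packed, measured from `0`. -/
noncomputable def free {ι : Type*} [Fintype ι] (w h : ι → ℝ) (H : ℝ) (s : ι → ℝ) (l x : ℝ) : ℝ :=
  x - ∑ j ∈ leftTall w h H s l, max 0 (min (w j) (x - s j))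

/-- The mirror image of a packing. -/
def mirror {ι : Type*} (w : ι → ℝ) (D : ℝ) (s : ι → ℝ) : ι → ℝ := fun i => D - s i - w i

section

variable {ι : Type*} [Fintype ι] {w h s : ι → ℝ} {D H l r : ℝ}

theorem mem_leftTall {j : ι} : j ∈ leftTall w h H s l ↔ H / 2 < h j ∧ s j + w j ≤ l := by
  simp [leftTall]

theorem mem_rightTall {j : ι} : j ∈ rightTall h H s r ↔ H / 2 < h j ∧ r ≤ s j := by
  simp [rightTall]

/-- Pairwise disjoint intervals cover no more than the length of an interval. -/
theorem sum_overlap_le (J : Finset ι)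
    (hJ : ∀ i ∈ J, ∀ j ∈ J, i ≠ j → s i + w i ≤ s j ∨ s j + w j ≤ s i) {x y : ℝ} (hxy : x ≤ y) :
    ∑ j ∈ J, max (min (s j + w j) y - max (s j) x) 0 ≤ y - x := by
  have hd : Set.PairwiseDisjoint (↑J)
      (fun j => Set.Ico (max (s j) x) (min (s j + w j) y)) := by
    intro i hi j hj hij
    refine Set.disjoint_left.2 fun t ht ht' => ?_
    have h1 := (max_le_iff.1 ht.1).1
    have h2 := (lt_min_iff.1 ht.2).1
    have h3 := (max_le_iff.1 ht'.1).1
    have h4 := (lt_min_iff.1 ht'.2).1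
    rcases hJ i hi j hj hij with h | h <;> linarith
  have h1 := MeasureTheory.measureReal_biUnion_finset (μ := MeasureTheory.volume) hd
    (fun j _ => measurableSet_Ico) (fun _ _ => measure_Ico_lt_top.ne)
  have h2 : MeasureTheory.volume.real
      (⋃ j ∈ J, Set.Ico (max (s j) x) (min (s j + w j) y)) ≤
      MeasureTheory.volume.real (Set.Ico x y) := by
    refine MeasureTheory.measureReal_mono ?_ (by simp)
    refine Set.iUnion₂_subset fun j _ => Set.Ico_subset_Ico (le_max_right _ _) (min_le_right _ _)
  rw [h1] at h2
  simpa [Real.volume_real_Ico, hxy] using h2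

theorem sum_width_le (J : Finset ι)
    (hJ : ∀ i ∈ J, ∀ j ∈ J, i ≠ j → s i + w i ≤ s j ∨ s j + w j ≤ s i) {x y : ℝ} (hxy : x ≤ y)
    (hx : ∀ j ∈ J, x ≤ s j) (hy : ∀ j ∈ J, s j + w j ≤ y) : ∑ j ∈ J, w j ≤ y - x := by
  refine le_trans (Finset.sum_le_sum fun j hj => ?_) (sum_overlap_le J hJ hxy)
  rw [max_eq_left (hx j hj), min_eq_left (hy j hj)]
  exact le_max_of_le_left (by linarith)

/-! ### Reflection, free width, and loads next to a tall item. -/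

namespace GapConfig

theorem tall_disjoint (c : GapConfig w h D H s l r) {i j : ι} (hi : H / 2 < h i) (hj : H / 2 < h j)
    (hij : i ≠ j) : s i + w i ≤ s j ∨ s j + w j ≤ s i := by
  classical
  by_contra hcon
  push Not at hcon
  have := c.load {i, j} (by
    intro a ha b hb
    simp only [Finset.mem_insert, Finset.mem_singleton] at ha hb
    have := c.w_pos i
    have := c.w_pos j
    rcases ha with rfl | rfl <;> rcases hb with rfl | rfl <;> linarith)
  rw [Finset.sum_pair hij] at this
  linarith

theorem mirror (c : GapConfig w h D H s l r) :
    GapConfig w h D H (DSP.mirror w D s) (D - r) (D - l) where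
  w_pos := c.w_pos
  h_nonneg := c.h_nonneg
  s_nonneg i := by have := c.end_le i; simp only [DSP.mirror]; linarith
  end_le i := by have := c.s_nonneg i; simp only [DSP.mirror]; linarith
  load S hS := c.load S fun i hi k hk => by
    have := hS k hk i hi; simp only [DSP.mirror] at this; linarith
  l_nonneg := by linarith [c.r_le]
  l_lt_r := by linarith [c.l_lt_r]
  r_le := by linarith [c.l_nonneg]
  tall_side i hi := by
    simp only [DSP.mirror]
    rcases c.tall_side i hi with h | h
    · right; linarith
    · left; linarith
  left_tall hl := by
    obtain ⟨j, hj, h⟩ := c.right_tall (by linarith)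
    exact ⟨j, hj, by simp only [DSP.mirror]; linarith⟩
  right_tall hl := by
    obtain ⟨j, hj, h⟩ := c.left_tall (by linarith)
    exact ⟨j, hj, by simp only [DSP.mirror]; linarith⟩

theorem leftTall_mirror (D : ℝ) :
    leftTall w h H (DSP.mirror w D s) (D - r) = rightTall h H s r := by
  ext j
  simp only [mem_leftTall, mem_rightTall, DSP.mirror]
  constructor <;> rintro ⟨h1, h2⟩ <;> exact ⟨h1, by linarith⟩

theorem rightTall_mirror (D : ℝ) :
    rightTall h H (DSP.mirror w D s) (D - l) = leftTall w h H s l := by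
  ext j
  simp only [mem_leftTall, mem_rightTall, DSP.mirror]
  constructor <;> rintro ⟨h1, h2⟩ <;> exact ⟨h1, by linarith⟩

/-- The tall items are pairwise disjoint, so they cover at most y - x of [x, y). -/
theorem free_mono (c : GapConfig w h D H s l r) {x y : ℝ} (hxy : x ≤ y) :
    free w h H s l x ≤ free w h H s l y := by
  have h1 := sum_overlap_le (s := s) (w := w) (leftTall w h H s l) (fun i hi j hj hij =>
    c.tall_disjoint (mem_leftTall.1 hi).1 (mem_leftTall.1 hj).1 hij) hxy
  have h2 : ∑ j ∈ leftTall w h H s l, max 0 (min (w j) (y - s j)) -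
      ∑ j ∈ leftTall w h H s l, max 0 (min (w j) (x - s j)) ≤
      ∑ j ∈ leftTall w h H s l, max (min (s j + w j) y - max (s j) x) 0 := by
    rw [← Finset.sum_sub_distrib]
    refine Finset.sum_le_sum fun j _ => ?_
    have := c.w_pos j
    rcases le_total (w j) (y - s j) with h1 | h1 <;> rcases le_total (w j) (x - s j) with h2 | h2 <;>
    rcases le_total (s j + w j) y with h3 | h3 <;> rcases le_total (s j) x with h4 | h4 <;>
    simp only [h1, h2, h3, h4, min_eq_left, min_eq_right, max_eq_left, max_eq_right] <;>
    grind
  unfold free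
  linarith

theorem free_zero (c : GapConfig w h D H s l r) : free w h H s l 0 = 0 := by
  unfold free
  rw [Finset.sum_eq_zero, sub_zero]
  intro j _
  have := c.s_nonneg j
  exact max_eq_left (le_trans (min_le_right _ _) (by linarith))

theorem free_nonneg (c : GapConfig w h D H s l r) {x : ℝ} (hx : 0 ≤ x) :
    0 ≤ free w h H s l x := c.free_zero ▸ c.free_mono hx

theorem free_l (c : GapConfig w h D H s l r) :
    free w h H s l l = l - ∑ j ∈ leftTall w h H s l, w j := by
  unfold free
  congr 1
  refine Finset.sum_congr rfl fun j hj => ?_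
  have := (mem_leftTall.1 hj).2
  rw [min_eq_left (by linarith), max_eq_right (c.w_pos j).le]

theorem free_add {x y : ℝ} (hxy : x ≤ y)
    (hJ : ∀ j ∈ leftTall w h H s l, s j + w j ≤ x ∨ y ≤ s j) :
    free w h H s l y = free w h H s l x + (y - x) := by
  unfold free
  have : ∑ j ∈ leftTall w h H s l, max 0 (min (w j) (y - s j)) =
      ∑ j ∈ leftTall w h H s l, max 0 (min (w j) (x - s j)) := by
    refine Finset.sum_congr rfl fun j hj => ?_
    rcases hJ j hj with h | h
    · rw [min_eq_left (by linarith), min_eq_left (by linarith)]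
    · rw [max_eq_left (le_trans (min_le_right _ _) (by linarith)),
        max_eq_left (le_trans (min_le_right _ _) (by linarith))]
  linarith

theorem sum_width_le_sub_free {J : Finset ι}
    (hJ : J ⊆ leftTall w h H s l) {u : ℝ} (hu : ∀ j ∈ J, s j + w j ≤ u) :
    ∑ j ∈ J, w j ≤ u - free w h H s l u := by
  unfold free
  rw [sub_sub_cancel]
  refine le_trans (Finset.sum_le_sum fun j hj => ?_)
    (Finset.sum_le_sum_of_subset_of_nonneg hJ fun j _ _ => le_max_left _ _)
  rw [min_eq_left (by linarith [hu j hj])]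
  exact le_max_right _ _

/-- The items packed at a common point. -/
theorem load_at (c : GapConfig w h D H s l r) (S : Finset ι) (t : ℝ)
    (hS : ∀ i ∈ S, s i ≤ t ∧ t < s i + w i) : ∑ i ∈ S, h i ≤ H :=
  c.load S fun i hi k hk => lt_of_le_of_lt (hS i hi).1 (hS k hk).2

/-- Items that are pairwise packed together at some time, and each together with the item `j`. -/
theorem load_tall (c : GapConfig w h D H s l r) (S : Finset ι) {j : ι} (hjS : j ∉ S)
    (hS : ∀ i ∈ S, ∀ k ∈ S, s i < s k + w k) (hj : ∀ i ∈ S, s i < s j + w j ∧ s j < s i + w i) :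
    ∑ i ∈ S, h i ≤ H - h j := by
  classical
  have := c.load (insert j S) (by
    intro a ha b hb
    have := c.w_pos j
    rcases Finset.mem_insert.1 ha with ha' | ha' <;> rcases Finset.mem_insert.1 hb with hb' | hb'
    · rw [ha', hb']; linarith
    · rw [ha']; exact (hj b hb').2
    · rw [hb']; exact (hj a ha').1
    · exact hS a ha' b hb')
  rw [Finset.sum_insert hjS] at this
  linarith

/-- An item across l forces l > 0, so a tall item ends at l. It meets every item across l, which
leaves less than H/2 for them. -/
theorem load_cross_l (c : GapConfig w h D H s l r) (S : Finset ι)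
    (hS : ∀ i ∈ S, s i < l ∧ l < s i + w i) : ∑ i ∈ S, h i ≤ H / 2 := by
  rcases S.eq_empty_or_nonempty with rfl | ⟨i, hi⟩
  · have := c.load ∅ (by simp)
    simp at this ⊢; linarith
  · obtain ⟨j, hj, hjl⟩ := c.left_tall (by linarith [c.s_nonneg i, hS i hi])
    have := c.load_tall S (j := j) (fun h => by linarith [hS j h])
      (fun a ha b hb => (hS a ha).1.trans (hS b hb).2)
      (fun a ha => ⟨by linarith [hS a ha], by linarith [hS a ha, c.w_pos j]⟩)
    linarith

theorem load_cross_r (c : GapConfig w h D H s l r) (S : Finset ι)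
    (hS : ∀ i ∈ S, s i < r ∧ r < s i + w i) : ∑ i ∈ S, h i ≤ H / 2 := by
  refine c.mirror.load_cross_l S fun i hi => ?_
  have := hS i hi
  simp only [DSP.mirror]
  constructor <;> linarith

/-- An item that ends by `l` and is packed together with a tall item just before `q`, but not
between `q` and its end. -/
structure _root_.DSP.LastTouch (w h : ι → ℝ) (H : ℝ) (s : ι → ℝ) (l : ℝ) (i : ι) (q : ℝ) :
    Prop where
  s_lt : s i < q
  le_end : q ≤ s i + w i
  end_le : s i + w i ≤ l
  tall : ∃ j ∈ leftTall w h H s l, s j < q ∧ q ≤ s j + w j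
  no_tall : q < s i + w i → ∀ j ∈ leftTall w h H s l, s j + w j ≤ q ∨ s i + w i ≤ s j

theorem exists_lastTouch (c : GapConfig w h D H s l r) :
    ∃ q : ι → ℝ, ∀ i, s i + w i ≤ l →
      (∃ j ∈ leftTall w h H s l, s i < s j + w j ∧ s j < s i + w i) →
      LastTouch w h H s l i (q i) := by
  classical
  suffices h : ∀ i, ∃ q : ℝ, s i + w i ≤ l →
      (∃ j ∈ leftTall w h H s l, s i < s j + w j ∧ s j < s i + w i) →
      LastTouch w h H s l i q by
    choose q hq using h
    exact ⟨q, hq⟩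
  intro i
  by_cases ht : ∃ j ∈ leftTall w h H s l, s i < s j + w j ∧ s j < s i + w i
  · obtain ⟨j0, hj0, hj0'⟩ := ht
    -- The contact point is the latest end of a tall item that meets i, cut off at the end of i.
    obtain ⟨j, hj, hmax⟩ := Finset.exists_max_image
      ((leftTall w h H s l).filter fun j => s i < s j + w j ∧ s j < s i + w i)
      (fun j => min (s i + w i) (s j + w j)) ⟨j0, by simp [hj0, hj0']⟩
    rw [Finset.mem_filter] at hj
    have hwi := c.w_pos i
    have hwj := c.w_pos j
    refine ⟨min (s i + w i) (s j + w j), fun hl _ => ⟨lt_min (by linarith) hj.2.1, min_le_left _ _, hl,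
      ⟨j, hj.1, lt_min hj.2.2 (by linarith), min_le_right _ _⟩, fun hq k hk => ?_⟩⟩
    by_contra hcon
    push Not at hcon
    have hki : s i < s k + w k :=
      lt_trans (lt_min (by linarith) hj.2.1) hcon.1
    have := hmax k (by rw [Finset.mem_filter]; exact ⟨hk, hki, hcon.2⟩)
    rcases le_total (s i + w i) (s k + w k) with h1 | h1
    · rw [min_eq_left h1] at this
      linarith
    · rw [min_eq_right h1] at this
      linarith
  · exact ⟨0, fun _ h => absurd h ht⟩

end GapConfig

/-! ### Splitting loads: covers, first-fit groups, windows. -/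

theorem sum_le_add_of_cover {S : Finset ι} {p q : ι → Prop} {a b : ℝ}
    (hpq : ∀ i ∈ S, p i ∨ q i)
    (hp : ∀ A ⊆ S, (∀ i ∈ A, p i) → ∑ i ∈ A, h i ≤ a)
    (hq : ∀ A ⊆ S, (∀ i ∈ A, q i) → ∑ i ∈ A, h i ≤ b) : ∑ i ∈ S, h i ≤ a + b := by
  classical
  have h1 := hp (S.filter p) (Finset.filter_subset _ _) (fun i hi => (Finset.mem_filter.1 hi).2)
  have h2 := hq (S.filter fun i => ¬ p i) (Finset.filter_subset _ _) (fun i hi =>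
    (hpq i (Finset.mem_filter.1 hi).1).resolve_left (Finset.mem_filter.1 hi).2)
  rw [← Finset.sum_filter_add_sum_filter_not S p]
  linarith

/-- First-fit colouring of items in the order of their starting points. -/
theorem exists_coloring (hl : ∀ S : Finset ι, (∀ i ∈ S, ∀ k ∈ S, s i < s k + w k) →
      ∑ i ∈ S, h i ≤ H) (hw : ∀ i, 0 < w i) (hn : ∀ i, 0 ≤ h i) (n : ℕ) (cap : ℝ) (hcap : 0 ≤ cap)
    (hn0 : 0 < n) (M : Finset ι)
    (hfit : ∀ i ∈ M, ∀ A ⊆ M, ∑ k ∈ A, h k + h i ≤ H → ∀ f : ι → ℕ, (∀ k, f k < n) →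
      ∃ j < n, ∑ k ∈ A with f k = j, h k + h i ≤ cap) :
    ∃ f : ι → ℕ, (∀ i, f i < n) ∧ ∀ A ⊆ M, (∀ i ∈ A, ∀ k ∈ A, s i < s k + w k) →
      ∀ j, (∀ i ∈ A, f i = j) → ∑ i ∈ A, h i ≤ cap := by
  classical
  induction M using Finset.induction_on_max_value s with
  | empty =>
    refine ⟨fun _ => 0, fun _ => hn0, fun A hA _ _ _ => ?_⟩
    rw [Finset.subset_empty.1 hA]; simpa
  | insert i M hi hmax ih =>
    obtain ⟨f, hf, hfA⟩ := ih fun k hk A hA =>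
      hfit k (Finset.mem_insert_of_mem hk) A (hA.trans (Finset.subset_insert _ _))
    -- Items are added by increasing start, so all earlier items that meet i are packed at its
    -- starting point.
    have hB : ∑ k ∈ M with s i < s k + w k, h k + h i ≤ H := by
      have := hl (insert i (M.filter fun k => s i < s k + w k)) (by
        have : ∀ a ∈ insert i (M.filter fun k => s i < s k + w k), s a ≤ s i ∧ s i < s a + w a := by
          intro a ha
          rcases Finset.mem_insert.1 ha with rfl | ha
          · exact ⟨le_rfl, by linarith [hw a]⟩
          · exact ⟨hmax a (Finset.mem_filter.1 ha).1, (Finset.mem_filter.1 ha).2⟩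
        exact fun a ha b hb => (this a ha).1.trans_lt (this b hb).2)
      rw [Finset.sum_insert (by simp [hi])] at this
      linarith
    obtain ⟨j, hj, hle⟩ := hfit i (Finset.mem_insert_self _ _) _
      ((Finset.filter_subset _ _).trans (Finset.subset_insert _ _)) hB f hf
    refine ⟨Function.update f i j, fun k => ?_, fun A hA hov j' hj' => ?_⟩
    · rcases eq_or_ne k i with rfl | h <;> simp [*]
    · by_cases hiA : i ∈ A
      · have hjj := hj' i hiA
        rw [Function.update_self] at hjj
        subst hjj
        rw [← Finset.sum_erase_add _ _ hiA]
        refine le_trans (add_le_add (Finset.sum_le_sum_of_subset_of_nonneg ?_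
          fun k _ _ => hn k) le_rfl) hle
        intro k hk
        have hki := Finset.ne_of_mem_erase hk
        have hkA := Finset.mem_of_mem_erase hk
        have hkj := hj' k hkA
        rw [Function.update_of_ne hki] at hkj
        simp only [Finset.mem_filter]
        exact ⟨⟨(Finset.mem_insert.1 (hA hkA)).resolve_left hki, hov i hiA k hkA⟩, hkj⟩
      · refine hfA A (fun k hk => (Finset.mem_insert.1 (hA hk)).resolve_left ?_) hov j' ?_
        · rintro rfl; exact hiA hk
        · intro k hk
          have := hj' k hk
          rwa [Function.update_of_ne (by rintro rfl; exact hiA hk)] at this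

theorem sum_filter_lt_three (A : Finset ι) (f : ι → ℕ) (hf : ∀ k, f k < 3) :
    ∑ k ∈ A, h k = ∑ k ∈ A with f k = 0, h k + ∑ k ∈ A with f k = 1, h k +
      ∑ k ∈ A with f k = 2, h k := by
  rw [← Finset.sum_fiberwise_of_maps_to (s := A) (t := Finset.range 3) (g := f)
    (fun k _ => Finset.mem_range.2 (hf k))]
  simp [Finset.sum_range_succ]

/-- Three groups if a group may have two thirds of the load. -/
theorem exists_coloring_three (hl : ∀ S : Finset ι, (∀ i ∈ S, ∀ k ∈ S, s i < s k + w k) →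
      ∑ i ∈ S, h i ≤ H) (hw : ∀ i, 0 < w i) (hn : ∀ i, 0 ≤ h i) (cap : ℝ) (hcap : 2 / 3 * H ≤ cap)
    (M : Finset ι) (hM : ∀ i ∈ M, h i ≤ H / 2) :
    ∃ f : ι → ℕ, (∀ i, f i < 3) ∧ ∀ A ⊆ M, (∀ i ∈ A, ∀ k ∈ A, s i < s k + w k) →
      ∀ j, (∀ i ∈ A, f i = j) → ∑ i ∈ A, h i ≤ cap := by
  have hH : 0 ≤ H := by simpa using hl ∅ (by simp)
  refine exists_coloring hl hw hn 3 cap (by linarith) (by norm_num) M ?_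
  intro i hi A _ hA f hf
  by_contra! hcon
  have := hcon 0 (by norm_num)
  have := hcon 1 (by norm_num)
  have := hcon 2 (by norm_num)
  rw [sum_filter_lt_three A f hf] at hA
  -- If no group accepts i, then 3 · cap < H + 2 · h i ≤ 2H.
  linarith [hM i hi]

/-- Six groups of half of the load. -/
theorem exists_coloring_six (hl : ∀ S : Finset ι, (∀ i ∈ S, ∀ k ∈ S, s i < s k + w k) →
      ∑ i ∈ S, h i ≤ H) (hw : ∀ i, 0 < w i) (hn : ∀ i, 0 ≤ h i)
    (M : Finset ι) (hM : ∀ i ∈ M, h i ≤ H / 2) :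
    ∃ f : ι → ℕ, (∀ i, f i < 6) ∧ ∀ A ⊆ M, (∀ i ∈ A, ∀ k ∈ A, s i < s k + w k) →
      ∀ j, (∀ i ∈ A, f i = j) → ∑ i ∈ A, h i ≤ H / 2 := by
  classical
  have hH : 0 ≤ H := by simpa using hl ∅ (by simp)
  -- For items of height at most H/4: three groups refusing i would give 3(H/2 - h i) < H - h i,
  -- hence h i > H/4.
  obtain ⟨f, hf, hfA⟩ := exists_coloring hl hw hn 3 (H / 2) (by linarith) (by norm_num)
    (M.filter fun i => h i ≤ H / 4) (by
      intro i hi A _ hA f hf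
      have := (Finset.mem_filter.1 hi).2
      by_contra! hcon
      have := hcon 0 (by norm_num)
      have := hcon 1 (by norm_num)
      have := hcon 2 (by norm_num)
      rw [sum_filter_lt_three A f hf] at hA
      linarith)
  obtain ⟨g, hg, hgA⟩ := exists_coloring hl hw hn 3 (H / 2) (by linarith) (by norm_num)
    (M.filter fun i => ¬ h i ≤ H / 4) (by
      intro i hi A hAM hA f hf
      have h1 := (Finset.mem_filter.1 hi)
      by_contra! hcon
      -- For the higher items: an empty group accepts i, so a refusing group holds an item and
      -- exceeds H/4. Three such groups and i itself exceed H.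
      have key : ∀ j < 3, H / 4 < ∑ k ∈ A with f k = j, h k := by
        intro j hj
        have := hcon j hj
        have h2 := hM i h1.1
        rcases (A.filter fun k => f k = j).eq_empty_or_nonempty with h | ⟨k, hk⟩
        · rw [h] at this; simp at this; linarith
        · have h3 := (Finset.mem_filter.1 (hAM (Finset.mem_filter.1 hk).1)).2
          have h4 := Finset.single_le_sum (f := h) (fun k _ => hn k) hk
          push Not at h3
          linarith
      have := key 0 (by norm_num)
      have := key 1 (by norm_num)
      have := key 2 (by norm_num)
      rw [sum_filter_lt_three A f hf] at hA
      have := h1.2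
      push Not at this
      linarith)
  refine ⟨fun i => if h i ≤ H / 4 then f i else 3 + g i, fun i => ?_, fun A hA hov j hj => ?_⟩
  · have := hf i
    have := hg i
    dsimp only
    split_ifs <;> omega
  · dsimp only at hj
    by_cases hj3 : j < 3
    · have : ∀ i ∈ A, h i ≤ H / 4 ∧ f i = j := by
        intro i hi
        have := hj i hi
        split_ifs at this with h1
        · exact ⟨h1, this⟩
        · omega
      exact hfA A (fun i hi => Finset.mem_filter.2 ⟨hA hi, (this i hi).1⟩) hov j
        fun i hi => (this i hi).2
    · have : ∀ i ∈ A, ¬ h i ≤ H / 4 ∧ g i = j - 3 := by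
        intro i hi
        have := hj i hi
        split_ifs at this with h1
        · have := hf i
          omega
        · exact ⟨h1, by omega⟩
      exact hgA A (fun i hi => Finset.mem_filter.2 ⟨hA hi, (this i hi).1⟩) hov (j - 3)
        fun i hi => (this i hi).2

/-- One of `n` disjoint windows holds at most the `n`-th part of the total height. -/
theorem exists_window (hn : ∀ i, 0 ≤ h i) (A : Finset ι) (e : ι → ℝ) (n : ℕ) (hn0 : 0 < n)
    (x W : ℝ) (hW : 0 ≤ W) : ∃ m < n, ∀ B ⊆ A, (∀ i ∈ B, x + m * W < e i ∧ e i < x + (m + 1) * W) →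
      n * ∑ i ∈ B, h i ≤ ∑ i ∈ A, h i := by
  classical
  have hdis : ∑ m ∈ Finset.range n, ∑ i ∈ A with x + m * W < e i ∧ e i < x + (m + 1) * W, h i ≤
      ∑ i ∈ A, h i := by
    rw [← Finset.sum_biUnion]
    · refine Finset.sum_le_sum_of_subset_of_nonneg ?_ fun i _ _ => hn i
      intro i hi
      obtain ⟨m, _, hm⟩ := Finset.mem_biUnion.1 hi
      exact (Finset.mem_filter.1 hm).1
    · intro a _ b _ hab
      refine Finset.disjoint_left.2 fun i hi hi' => ?_
      have h1 := (Finset.mem_filter.1 hi).2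
      have h2 := (Finset.mem_filter.1 hi').2
      rcases lt_or_gt_of_ne hab with hlt | hlt
      · have : (a : ℝ) + 1 ≤ b := by exact_mod_cast hlt
        nlinarith
      · have : (b : ℝ) + 1 ≤ a := by exact_mod_cast hlt
        nlinarith
  obtain ⟨m, hm, hle⟩ := Finset.exists_min_image (Finset.range n)
    (fun m : ℕ => ∑ i ∈ A with x + m * W < e i ∧ e i < x + (m + 1) * W, h i)
    ⟨0, Finset.mem_range.2 hn0⟩
  refine ⟨m, Finset.mem_range.1 hm, fun B hB hBm => ?_⟩
  have h1 : ∑ i ∈ B, h i ≤ ∑ i ∈ A with x + m * W < e i ∧ e i < x + (m + 1) * W, h i :=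
    Finset.sum_le_sum_of_subset_of_nonneg
      (fun i hi => Finset.mem_filter.2 ⟨hB hi, hBm i hi⟩) fun i _ _ => hn i
  have h2 := Finset.card_nsmul_le_sum (Finset.range n) _ _ hle
  rw [Finset.card_range, nsmul_eq_mul] at h2
  have : (n : ℝ) * ∑ i ∈ B, h i ≤
      n * ∑ i ∈ A with x + m * W < e i ∧ e i < x + (m + 1) * W, h i :=
    mul_le_mul_of_nonneg_left h1 (Nat.cast_nonneg n)
  linarith

/-! ### Items delayed by the free width up to their last contact. -/

namespace LastTouch

variable {i : ι} {q : ℝ}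

theorem free_end (t : LastTouch w h H s l i q) :
    free w h H s l (s i + w i) = free w h H s l q + (s i + w i - q) := by
  rcases t.le_end.eq_or_lt with h | h
  · rw [← h]; ring
  · exact GapConfig.free_add t.le_end (t.no_tall h)

/-- Items that are moved to the right by the free width up to their last contact with a tall item
meet only if they already met there. -/
theorem lt_of_shifted_lt (t : LastTouch w h H s l i q) (c : GapConfig w h D H s l r)
    {x y sh : ℝ} (hxy : x < y) (hsh : free w h H s l y ≤ sh)
    (hy : y < s i + w i → ∃ j ∈ leftTall w h H s l, s j < y ∧ y ≤ s j + w j)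
    (hlt : x + sh < s i + w i + free w h H s l q) : x < q := by
  by_contra! hqx
  -- The delayed end of i equals q plus the free width up to the old end of i, because no tall item
  -- is packed between q and that end.
  have hf := t.free_end
  rcases le_or_gt (s i + w i) y with h1 | h1
  · have := c.free_mono h1
    linarith
  · obtain ⟨j, hj, hj1, hj2⟩ := hy h1
    rcases t.no_tall (by linarith) j hj with h2 | h2 <;> linarith

/-- Supplies the condition `hq` of `load_right_aligned`: a tall item ending after q starts only
after i has ended, so the free width up to its end includes the stretch from q to the end of i. -/
theorem lt_add_free (t : LastTouch w h H s l i q) (c : GapConfig w h D H s l r) {τ : ℝ}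
    (hτ : τ < s i + w i + free w h H s l q) {k : ι} (hk : k ∈ leftTall w h H s l)
    (hqk : q < s k + w k) : τ < q + free w h H s l (s k + w k) := by
  have hf := t.free_end
  rcases t.le_end.eq_or_lt with h | h
  · have := c.free_mono hqk.le
    linarith
  · rcases t.no_tall h k hk with h2 | h2
    · linarith
    · have := c.free_mono (x := s i + w i) (y := s k + w k) (by linarith [c.w_pos k])
      linarith

/-- Items packed together just before the last contact of an item with a tall item. -/
theorem load_before (t : LastTouch w h H s l i q) (c : GapConfig w h D H s l r) (A : Finset ι)
    (hA : ∀ k ∈ A, h k ≤ H / 2 ∧ s k < q ∧ q ≤ s k + w k) : ∑ k ∈ A, h k ≤ H / 2 := by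
  obtain ⟨j, hj, h1, h2⟩ := t.tall
  have hj := (mem_leftTall.1 hj).1
  have := c.load_tall A (j := j) (fun hjA => by linarith [hA j hjA])
    (fun a ha b hb => (hA a ha).2.1.trans_le (hA b hb).2.2)
    (fun a ha => ⟨(hA a ha).2.1.trans_le h2, h1.trans_le (hA a ha).2.2⟩)
  linarith

end LastTouch

/-! ### Loads in the range of the sorted tall items. -/

namespace GapConfig

open Classical in
/-- The tall items of height at least `x` have total width at most that of those on the left and
those on the right. -/
theorem sum_width_tall (c : GapConfig w h D H s l r) (x : ℝ) :
    ∑ k with H / 2 < h k ∧ x ≤ h k, w k =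
      ∑ k ∈ leftTall w h H s l with x ≤ h k, w k + ∑ k ∈ rightTall h H s r with x ≤ h k, w k := by
  rw [← Finset.sum_union]
  · refine Finset.sum_congr ?_ fun _ _ => rfl
    ext k
    simp only [Finset.mem_filter, Finset.mem_univ, true_and, Finset.mem_union, mem_leftTall,
      mem_rightTall]
    have := c.tall_side k
    tauto
  · refine Finset.disjoint_left.2 fun k h1 h2 => ?_
    have h1 := (mem_leftTall.1 (Finset.mem_filter.1 h1).1).2
    have h2 := (mem_rightTall.1 (Finset.mem_filter.1 h2).1).2
    linarith [c.w_pos k, c.l_lt_r]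

open Classical in
/-- Items that are packed as far to the right as possible. -/
theorem load_right_aligned (c : GapConfig w h D H s l r) (A : Finset ι) {τ q x : ℝ}
    (hov : ∀ i ∈ A, ∀ k ∈ A, s i < s k + w k)
    (hA : ∀ i ∈ A, h i ≤ H / 2 ∧ l < s i + w i ∧ s i < r ∧ D - w i ≤ τ ∧ q ≤ s i) (hq0 : 0 ≤ q)
    (hτ : τ < ∑ k with H / 2 < h k ∧ x ≤ h k, w k)
    (hq : ∀ k ∈ leftTall w h H s l, q < s k + w k → τ < q + free w h H s l (s k + w k))
    (hxH : x ≤ H) :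
    ∑ i ∈ A, h i ≤ H - x := by
  rcases A.eq_empty_or_nonempty with rfl | hne
  · simpa using hxH
  by_contra! hcon
  rw [c.sum_width_tall] at hτ
  -- If the load exceeds H - x, no tall item of height at least x meets all of A. Hence those on the
  -- right start after the earliest end in A, and those on the left end before the latest start.
  -- Together they are then too narrow to exceed τ.
  have hno : ∀ j, H / 2 < h j → x ≤ h j → ¬ ∀ i ∈ A, s i < s j + w j ∧ s j < s i + w i := by
    intro j hj hxj hall
    have := c.load_tall A (j := j) (fun hjA => by linarith [hA j hjA]) hov hall
    linarith
  obtain ⟨i1, hi1, hmin⟩ := Finset.exists_min_image A (fun i => s i + w i) hne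
  obtain ⟨i2, hi2, hmax⟩ := Finset.exists_max_image A s hne
  have hA1 := hA i1 hi1
  have hA2 := hA i2 hi2
  have hR : ∑ k ∈ rightTall h H s r with x ≤ h k, w k ≤ D - (s i1 + w i1) := by
    refine sum_width_le (s := s) _ (fun i hi j hj hij => c.tall_disjoint
      (mem_rightTall.1 (Finset.mem_filter.1 hi).1).1 (mem_rightTall.1 (Finset.mem_filter.1 hj).1).1
      hij) (c.end_le i1) (fun j hj => ?_) fun j _ => c.end_le j
    obtain ⟨hj1, hj2⟩ := Finset.mem_filter.1 hj
    rw [mem_rightTall] at hj1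
    by_contra! hlt
    exact hno j hj1.1 hj2 fun i hi =>
      ⟨by linarith [hA i hi, c.w_pos j], hlt.trans_le (hmin i hi)⟩
  have hL : ∀ k ∈ leftTall w h H s l, x ≤ h k → s k + w k ≤ s i2 := by
    intro k hk hxk
    rw [mem_leftTall] at hk
    by_contra! hlt
    exact hno k hk.1 hxk fun i hi => ⟨(hmax i hi).trans_lt hlt, by
      linarith [hA i hi, c.w_pos k]⟩
  rcases ((leftTall w h H s l).filter fun k => x ≤ h k).eq_empty_or_nonempty with h0 | hne'
  · rw [h0, Finset.sum_empty] at hτ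
    linarith
  · obtain ⟨k, hk, hkmax⟩ := Finset.exists_max_image _ (fun k => s k + w k) hne'
    have h1 := sum_width_le_sub_free (w := w) (h := h) (H := H) (s := s) (l := l)
      (Finset.filter_subset (fun k => x ≤ h k) (leftTall w h H s l))
      (u := s k + w k) hkmax
    obtain ⟨hk1, hk2⟩ := Finset.mem_filter.1 hk
    have h3 := hL k hk1 hk2
    have h4 := c.end_le i2
    have h5 : 0 ≤ free w h H s l (s k + w k) :=
      c.free_nonneg (by linarith [c.s_nonneg k, c.w_pos k])
    have h6 := hq k hk1 (by linarith)
    linarith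

open Classical in
/-- Items across `l` that are shifted to the right by the width of the tall items on the right. -/
theorem load_shifted (c : GapConfig w h D H s l r) (A : Finset ι) {τ d x : ℝ}
    (hA : ∀ i ∈ A, h i ≤ H / 2 ∧ s i < l ∧ l < s i + w i ∧ s i + d ≤ τ)
    (hd : ∑ k ∈ rightTall h H s r, w k ≤ d)
    (hτ : τ < ∑ k with H / 2 < h k ∧ x ≤ h k, w k) (hxH : x ≤ H) :
    ∑ i ∈ A, h i ≤ H - x := by
  rcases A.eq_empty_or_nonempty with rfl | hne
  · simpa using hxH
  rw [c.sum_width_tall] at hτ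
  have hd' : ∑ k ∈ rightTall h H s r with x ≤ h k, w k ≤ d :=
    (Finset.sum_le_sum_of_subset_of_nonneg (Finset.filter_subset _ _)
      fun k _ _ => (c.w_pos k).le).trans hd
  obtain ⟨i2, hi2, hmax⟩ := Finset.exists_max_image A s hne
  have hA2 := hA i2 hi2
  -- Otherwise the left tall items of height at least x fit into [0, s i2), and all tall items of
  -- that height have width at most s i2 + d ≤ τ.
  obtain ⟨k, hk, hlt⟩ : ∃ k ∈ (leftTall w h H s l).filter fun k => x ≤ h k, s i2 < s k + w k := by
    by_contra! hcon
    have := sum_width_le (s := s) ((leftTall w h H s l).filter fun k => x ≤ h k)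
      (fun i hi j hj hij => c.tall_disjoint
        (mem_leftTall.1 (Finset.mem_filter.1 hi).1).1
        (mem_leftTall.1 (Finset.mem_filter.1 hj).1).1 hij) (c.s_nonneg i2)
      (fun j _ => c.s_nonneg j) hcon
    linarith
  obtain ⟨hk1, hk2⟩ := Finset.mem_filter.1 hk
  rw [mem_leftTall] at hk1
  have := c.load_tall A (j := k) (fun hkA => by linarith [hA k hkA])
    (fun a ha b hb => (hA a ha).2.1.trans (hA b hb).2.2.1)
    (fun a ha => ⟨(hmax a ha).trans_lt hlt, by linarith [hA a ha, c.w_pos k]⟩)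
  linarith

/-- Items that meet no tall item are disjoint in the free part only if they are disjoint. -/
theorem overlap_of_free (c : GapConfig w h D H s l r) {i k : ι}
    (hlt : free w h H s l (s i) < free w h H s l (s k + w k)) : s i < s k + w k := by
  by_contra! hcon
  linarith [c.free_mono hcon]

end GapConfig

/-! ### Sorted tall items and loose items. -/

open Classical in
/-- Starting points of the tall items side by side in non-increasing order of height. -/
structure TallPos (w h : ι → ℝ) (H : ℝ) (pos : ι → ℝ) : Prop where
  nonneg : ∀ i, H / 2 < h i → 0 ≤ pos i
  end_le : ∀ i, H / 2 < h i → pos i + w i ≤ ∑ k with H / 2 < h k ∧ h i ≤ h k, w k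
  disjoint : ∀ i k, H / 2 < h i → H / 2 < h k → i ≠ k →
    pos i + w i ≤ pos k ∨ pos k + w k ≤ pos i

-- At most one tall item is packed at τ, and it ends no later than the total width of the tall items
-- at least as high. It therefore suffices to bound the remaining items with and without such an
-- item.
open Classical in
theorem TallPos.load_le {pos σ : ι → ℝ} (p : TallPos w h H pos) {τ B : ℝ} {S : Finset ι}
    (hact : ∀ i ∈ S, σ i ≤ τ ∧ τ < σ i + w i) (hσ : ∀ i, H / 2 < h i → σ i = pos i)
    (h0 : ∀ A ⊆ S, (∀ i ∈ A, h i ≤ H / 2) → ∑ i ∈ A, h i ≤ B)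
    (h1 : ∀ j ∈ S, H / 2 < h j → τ < ∑ k with H / 2 < h k ∧ h j ≤ h k, w k →
      ∀ A ⊆ S, (∀ i ∈ A, h i ≤ H / 2) → ∑ i ∈ A, h i ≤ B - h j) :
    ∑ i ∈ S, h i ≤ B := by
  by_cases ht : ∃ j ∈ S, H / 2 < h j
  · obtain ⟨j, hjS, hj⟩ := ht
    have hend := p.end_le j hj
    have hj' := hact j hjS
    rw [hσ j hj] at hj'
    have := h1 j hjS hj (hj'.2.trans_le hend) (S.erase j) (Finset.erase_subset _ _) (by
      intro i hi
      by_contra! hcon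
      have hi' := hact i (Finset.mem_of_mem_erase hi)
      rw [hσ i hcon] at hi'
      rcases p.disjoint i j hcon hj (Finset.ne_of_mem_erase hi) with h | h <;> linarith)
    rw [← Finset.sum_erase_add _ _ hjS]
    linarith
  · push Not at ht
    exact h0 S subset_rfl ht

open Classical in
/-- The items that are packed to the left of `l` and never together with a tall item. -/
noncomputable def looseLeft (w h : ι → ℝ) (H : ℝ) (s : ι → ℝ) (l : ℝ) : Finset ι :=
  Finset.univ.filter fun i => h i ≤ H / 2 ∧ s i + w i ≤ l ∧
    ∀ j ∈ leftTall w h H s l, s j + w j ≤ s i ∨ s i + w i ≤ s j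

theorem mem_looseLeft {i : ι} : i ∈ looseLeft w h H s l ↔ h i ≤ H / 2 ∧ s i + w i ≤ l ∧
    ∀ j ∈ leftTall w h H s l, s j + w j ≤ s i ∨ s i + w i ≤ s j := by
  simp [looseLeft]

namespace GapConfig

theorem H_nonneg (c : GapConfig w h D H s l r) : 0 ≤ H := by simpa using c.load ∅ (by simp)

theorem free_end (c : GapConfig w h D H s l r) {i : ι} (hi : i ∈ looseLeft w h H s l) :
    free w h H s l (s i + w i) = free w h H s l (s i) + w i := by
  rw [free_add (by linarith [c.w_pos i]) (mem_looseLeft.1 hi).2.2]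
  ring

theorem free_end_le (c : GapConfig w h D H s l r) {i : ι} (hi : i ∈ looseLeft w h H s l) :
    free w h H s l (s i) + w i ≤ free w h H s l l := by
  rw [← c.free_end hi]
  exact c.free_mono (mem_looseLeft.1 hi).2.1

/-- The items to the left of `l` that are packed together with tall items are stretched by the free
width, and those across `l` follow them. -/
theorem load_stretched (c : GapConfig w h D H s l r) {A : Finset ι} {q sh : ι → ℝ}
    (hA : ∀ k ∈ A, h k ≤ H / 2 ∧
      ((LastTouch w h H s l k (q k) ∧ sh k = free w h H s l (q k)) ∨
        (s k < l ∧ l < s k + w k ∧ free w h H s l l ≤ sh k)))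
    (hov : ∀ i ∈ A, ∀ k ∈ A, s i + sh i < s k + w k + sh k) : ∑ k ∈ A, h k ≤ H / 2 := by
  classical
  rcases (A.filter fun k => LastTouch w h H s l k (q k) ∧
    sh k = free w h H s l (q k)).eq_empty_or_nonempty with h0 | hne
  · refine c.load_cross_l A fun k hk => ?_
    rcases (hA k hk).2 with h1 | h1
    · have : k ∈ A.filter fun k => LastTouch w h H s l k (q k) ∧ sh k = free w h H s l (q k) :=
        Finset.mem_filter.2 ⟨hk, h1⟩
      rw [h0] at this
      simp at this
    · exact ⟨h1.1, h1.2.1⟩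
  · obtain ⟨i, hi, hmin⟩ := Finset.exists_min_image _ q hne
    obtain ⟨hiA, t, hsh⟩ := Finset.mem_filter.1 hi
    refine t.load_before c A fun k hk => ⟨(hA k hk).1, ?_⟩
    have hik := hov k hk i hiA
    rw [hsh] at hik
    rcases (hA k hk).2 with h1 | h1
    · have hq := hmin k (Finset.mem_filter.2 ⟨hk, h1⟩)
      exact ⟨t.lt_of_shifted_lt c h1.1.s_lt h1.2.ge (fun _ => h1.1.tall) hik,
        hq.trans h1.1.le_end⟩
    · have := t.le_end
      have := t.end_le
      exact ⟨t.lt_of_shifted_lt c h1.1 h1.2.2 (fun _ => by linarith) hik, by linarith⟩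

/-- The loose items, packed in groups side by side. -/
theorem load_grouped (c : GapConfig w h D H s l r) {A : Finset ι} {f : ι → ℕ} {cap x τ : ℝ}
    (hcap : 0 ≤ cap) (hf : ∀ A ⊆ looseLeft w h H s l, (∀ i ∈ A, ∀ k ∈ A, s i < s k + w k) →
      ∀ j, (∀ i ∈ A, f i = j) → ∑ i ∈ A, h i ≤ cap)
    (hA : ∀ i ∈ A, i ∈ looseLeft w h H s l ∧
      x + f i * free w h H s l l + free w h H s l (s i) ≤ τ ∧
      τ < x + f i * free w h H s l l + free w h H s l (s i) + w i) : ∑ i ∈ A, h i ≤ cap := by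
  rcases A.eq_empty_or_nonempty with rfl | ⟨i, hi⟩
  · simpa
  -- Each group has its own strip of width `free w h H s l l`, so items packed at a common point lie
  -- in the same group.
  have hle : ∀ i ∈ A, ∀ k ∈ A, f i ≤ f k := by
    intro i hi k hk
    by_contra! hcon
    obtain ⟨i1, i2, i3⟩ := hA i hi
    obtain ⟨k1, k2, k3⟩ := hA k hk
    have h1 := c.free_end_le k1
    have h2 := c.free_nonneg (c.s_nonneg i)
    have h3 := c.free_nonneg c.l_nonneg
    have h4 : (f k : ℝ) + 1 ≤ f i := by exact_mod_cast hcon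
    nlinarith
  have heq : ∀ k ∈ A, f k = f i := fun k hk => le_antisymm (hle k hk i hi) (hle i hi k hk)
  refine hf A (fun k hk => (hA k hk).1) (fun a ha b hb => ?_) (f i) heq
  obtain ⟨a1, a2, a3⟩ := hA a ha
  obtain ⟨b1, b2, b3⟩ := hA b hb
  refine c.overlap_of_free ?_
  rw [c.free_end b1]
  rw [heq a ha] at a2
  rw [heq b hb] at b3
  linarith

theorem load_loose_mirrored (c : GapConfig w h D H s l r) {A : Finset ι} {τ : ℝ}
    (hA : ∀ i ∈ A, i ∈ looseLeft w h H s l ∧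
      D - free w h H s l (s i) - w i ≤ τ ∧ τ < D - free w h H s l (s i)) : ∑ i ∈ A, h i ≤ H := by
  refine c.load A fun a ha b hb => ?_
  obtain ⟨a1, a2, a3⟩ := hA a ha
  obtain ⟨b1, b2, b3⟩ := hA b hb
  refine c.overlap_of_free ?_
  rw [c.free_end b1]
  linarith

/-! ### The case gl ≤ d. -/

/-- The starting point of an item in the case that the tall items on the right are at least as wide as the
free part on the left. -/
theorem exists_start_of_le (c : GapConfig w h D H s l r) {pos q q' : ι → ℝ} {f : ι → ℕ} {n : ℕ}
    {d gl gr : ℝ} (hgl : gl = free w h H s l l)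
    (hgr : gr = free w h H (DSP.mirror w D s) (D - r) (D - r))
    (hq : ∀ i, s i + w i ≤ l →
      (∃ j ∈ leftTall w h H s l, s i < s j + w j ∧ s j < s i + w i) → LastTouch w h H s l i (q i))
    (hq' : ∀ i, DSP.mirror w D s i + w i ≤ D - r →
      (∃ j ∈ leftTall w h H (DSP.mirror w D s) (D - r),
        DSP.mirror w D s i < DSP.mirror w D s j + w j ∧
        DSP.mirror w D s j < DSP.mirror w D s i + w i) →
      LastTouch w h H (DSP.mirror w D s) (D - r) i (q' i))
    (hf : ∀ i, f i < n) (i : ι) :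
    ∃ x : ℝ, (H / 2 < h i ∧ x = pos i) ∨ (h i ≤ H / 2 ∧ (
      (LastTouch w h H s l i (q i) ∧ s i + w i ≤ l ∧ x = s i + free w h H s l (q i) ∧
        0 ≤ free w h H s l (q i) ∧ free w h H s l (q i) ≤ gl) ∨
      (s i < l ∧ l < s i + w i ∧ s i + w i ≤ r ∧ x = s i + d) ∨
      (s i < l ∧ r < s i + w i ∧ x = D - w i) ∨
      (l ≤ s i ∧ s i + w i ≤ r ∧ x = s i + d) ∨
      (l ≤ s i ∧ s i < r ∧ r < s i + w i ∧ s i ≤ l + gl + 2 * gr + n * gl ∧ x = D - w i) ∨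
      -- The threshold on `s i` ensures that an item moved left still starts after l + gl, beyond
      -- all delayed items.
      (l ≤ s i ∧ s i < r ∧ r < s i + w i ∧ l + gl + 2 * gr + n * gl < s i ∧
        x = s i - gr - (gr + n * gl)) ∨
      (LastTouch w h H (DSP.mirror w D s) (D - r) i (q' i) ∧ r ≤ s i ∧
        x = s i - free w h H (DSP.mirror w D s) (D - r) (q' i) - (gr + n * gl) ∧
        0 ≤ free w h H (DSP.mirror w D s) (D - r) (q' i) ∧
        free w h H (DSP.mirror w D s) (D - r) (q' i) ≤ gr) ∨
      (r ≤ s i ∧ i ∈ looseLeft w h H (DSP.mirror w D s) (D - r) ∧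
        x = D - free w h H (DSP.mirror w D s) (D - r) (DSP.mirror w D s i) - w i ∧
        D - gr ≤ x ∧ x + w i ≤ D) ∨
      (s i + w i ≤ l ∧ i ∈ looseLeft w h H s l ∧
        x = D - gr - n * gl + f i * gl + free w h H s l (s i) ∧
        D - gr - n * gl ≤ x ∧ x + w i ≤ D - gr))) := by
  have c' := c.mirror
  have hlr := c.l_lt_r
  have hgl0 : 0 ≤ gl := hgl ▸ c.free_nonneg c.l_nonneg
  rcases lt_or_ge (H / 2) (h i) with hi | hi
  · exact ⟨_, .inl ⟨hi, rfl⟩⟩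
  have hs' : DSP.mirror w D s i = D - s i - w i := rfl
  rcases le_or_gt (s i + w i) l with h1 | h1
  · by_cases ht : ∃ j ∈ leftTall w h H s l, s i < s j + w j ∧ s j < s i + w i
    · have t := hq i h1 ht
      refine ⟨_, .inr ⟨hi, .inl ⟨t, h1, rfl, c.free_nonneg ?_, hgl ▸ c.free_mono ?_⟩⟩⟩
      · linarith [t.s_lt, c.s_nonneg i]
      · linarith [t.le_end]
    · have hm : i ∈ looseLeft w h H s l := mem_looseLeft.2 ⟨hi, h1, fun j hj => by
        by_contra! hcon
        exact ht ⟨j, hj, hcon⟩⟩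
      have h2 := c.free_end_le hm
      have h3 := c.free_nonneg (c.s_nonneg i)
      have h4 : (f i : ℝ) + 1 ≤ n := by exact_mod_cast hf i
      have h5 : (0 : ℝ) ≤ f i := Nat.cast_nonneg _
      rw [← hgl] at h2
      refine ⟨_, .inr ⟨hi, .inr (.inr (.inr (.inr (.inr (.inr (.inr (.inr
        ⟨h1, hm, rfl, ?_, ?_⟩)))))))⟩⟩ <;> nlinarith
  rcases lt_or_ge (s i) l with h2 | h2
  · rcases le_or_gt (s i + w i) r with h3 | h3
    · exact ⟨_, .inr ⟨hi, .inr (.inl ⟨h2, h1, h3, rfl⟩)⟩⟩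
    · exact ⟨_, .inr ⟨hi, .inr (.inr (.inl ⟨h2, h3, rfl⟩))⟩⟩
  rcases le_or_gt (s i + w i) r with h3 | h3
  · exact ⟨_, .inr ⟨hi, .inr (.inr (.inr (.inl ⟨h2, h3, rfl⟩)))⟩⟩
  rcases lt_or_ge (s i) r with h4 | h4
  · rcases le_or_gt (s i) (l + gl + 2 * gr + n * gl) with h5 | h5
    · exact ⟨_, .inr ⟨hi, .inr (.inr (.inr (.inr (.inl ⟨h2, h4, h3, h5, rfl⟩))))⟩⟩
    · exact ⟨_, .inr ⟨hi, .inr (.inr (.inr (.inr (.inr (.inl ⟨h2, h4, h3, h5, rfl⟩)))))⟩⟩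
  have h5 : DSP.mirror w D s i + w i ≤ D - r := by rw [hs']; linarith
  by_cases ht : ∃ j ∈ leftTall w h H (DSP.mirror w D s) (D - r),
      DSP.mirror w D s i < DSP.mirror w D s j + w j ∧
      DSP.mirror w D s j < DSP.mirror w D s i + w i
  · have t := hq' i h5 ht
    refine ⟨_, .inr ⟨hi, .inr (.inr (.inr (.inr (.inr (.inr (.inl
      ⟨t, h4, rfl, c'.free_nonneg ?_, hgr ▸ c'.free_mono ?_⟩))))))⟩⟩
    · linarith [t.s_lt, c'.s_nonneg i]
    · linarith [t.le_end]
  · have hm : i ∈ looseLeft w h H (DSP.mirror w D s) (D - r) :=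
      mem_looseLeft.2 ⟨hi, h5, fun j hj => by
        by_contra! hcon
        exact ht ⟨j, hj, hcon⟩⟩
    have h2 := c'.free_end_le hm
    have h3 := c'.free_nonneg (c'.s_nonneg i)
    rw [← hgr] at h2
    refine ⟨_, .inr ⟨hi, .inr (.inr (.inr (.inr (.inr (.inr (.inr (.inl
        ⟨h4, hm, rfl, ?_, ?_⟩)))))))⟩⟩ <;> linarith

-- The strip [D - gr, D) takes the loose items of the right side, the strip of width n · gl before
-- it those of the left side. What was packed in the gap moves right by d and so ends by r + d = D -
-- gr.
open Classical in
theorem exists_packing_of_le (c : GapConfig w h D H s l r) {pos : ι → ℝ} (p : TallPos w h H pos)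
    {f : ι → ℕ} {n : ℕ} {cap gl gr : ℝ} (hgl : gl = free w h H s l l)
    (hgr : gr = D - r - ∑ k ∈ rightTall h H s r, w k)
    (hle : gl ≤ ∑ k ∈ rightTall h H s r, w k)
    (hwide : (D - r) + gl + 3 * gr + 2 * (n * gl) ≤ r - l) (hcap : H / 2 ≤ cap)
    (hf : ∀ i, f i < n)
    (hcol : ∀ A ⊆ looseLeft w h H s l, (∀ i ∈ A, ∀ k ∈ A, s i < s k + w k) →
      ∀ j, (∀ i ∈ A, f i = j) → ∑ i ∈ A, h i ≤ cap) :
    ∃ σ : ι → ℝ, (∀ i, 0 ≤ σ i ∧ σ i + w i ≤ D) ∧ (∀ i, H / 2 < h i → σ i = pos i) ∧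
      ∀ τ, ∀ S : Finset ι, (∀ i ∈ S, σ i ≤ τ ∧ τ < σ i + w i) → ∑ i ∈ S, h i ≤ H + cap := by
  have c' := c.mirror
  obtain ⟨q, hq⟩ := c.exists_lastTouch
  obtain ⟨q', hq'⟩ := c'.exists_lastTouch
  have hgr' : gr = free w h H (DSP.mirror w D s) (D - r) (D - r) := by
    rw [c'.free_l, leftTall_mirror, hgr]
  obtain ⟨d, hd⟩ : ∃ d, d = D - r - gr := ⟨_, rfl⟩
  have hdR : ∑ k ∈ rightTall h H s r, w k = d := by rw [hd, hgr]; ring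
  rw [hdR] at hle
  choose σ hσ using c.exists_start_of_le (pos := pos) (n := n) (d := d) hgl hgr' hq hq' hf
  have hl0 := c.l_nonneg
  have hlr := c.l_lt_r
  have hrD := c.r_le
  have hH := c.H_nonneg
  have hgl0 : 0 ≤ gl := hgl ▸ c.free_nonneg c.l_nonneg
  have hgr0 : 0 ≤ gr := hgr' ▸ c'.free_nonneg c'.l_nonneg
  have hn0 : 0 ≤ n * gl := mul_nonneg (Nat.cast_nonneg _) hgl0
  generalize hF : n * gl = F at *
  have hT : ∀ x : ℝ, ∑ k with H / 2 < h k ∧ x ≤ h k, w k ≤ l - gl + d := by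
    intro x
    rw [c.sum_width_tall]
    have h1 : ∑ k ∈ leftTall w h H s l with x ≤ h k, w k ≤ ∑ k ∈ leftTall w h H s l, w k :=
      Finset.sum_le_sum_of_subset_of_nonneg (Finset.filter_subset _ _) fun k _ _ => (c.w_pos k).le
    have h2 : ∑ k ∈ rightTall h H s r with x ≤ h k, w k ≤ ∑ k ∈ rightTall h H s r, w k :=
      Finset.sum_le_sum_of_subset_of_nonneg (Finset.filter_subset _ _) fun k _ _ => (c.w_pos k).le
    have h3 := c.free_l
    linarith
  refine ⟨σ, fun i => ?_, fun i hi => ?_, fun τ S hS => ?_⟩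
  · have hs := c.s_nonneg i
    have he := c.end_le i
    have hw := c.w_pos i
    rcases hσ i with ⟨h1, h2⟩ | ⟨h1, h2⟩
    · have h3 := p.nonneg i h1
      have h4 := p.end_le i h1
      have h5 := hT (h i)
      constructor <;> linarith
    · rcases h2 with ⟨h2, h3, h4, h5, h6⟩ | ⟨h2, h3, h4, h5⟩ | ⟨h2, h3, h4⟩ | ⟨h2, h3, h4⟩ |
        ⟨h2, h3, h4, h5, h6⟩ | ⟨h2, h3, h4, h5, h6⟩ | ⟨h2, h3, h4, h5, h6⟩ | ⟨h2, h3, h4, h5, h6⟩ |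
        ⟨h2, h3, h4, h5, h6⟩ <;> constructor <;> linarith
  · rcases hσ i with h1 | h1
    · exact h1.2
    · linarith [h1.1]
  -- With a delayed item present, let q be the smallest contact point. The other non-tall items were
  -- packed just before q, or are right-aligned across r and started at q or later.
  by_cases hL0 : ∃ i ∈ S, LastTouch w h H s l i (q i) ∧ σ i = s i + free w h H s l (q i)
  · obtain ⟨i, hi, hmin⟩ := Finset.exists_min_image (S.filter fun i =>
      LastTouch w h H s l i (q i) ∧ σ i = s i + free w h H s l (q i)) q (by
        obtain ⟨i, h1, h2⟩ := hL0
        exact ⟨i, Finset.mem_filter.2 ⟨h1, h2⟩⟩)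
    obtain ⟨hiS, t, hσi⟩ := Finset.mem_filter.1 hi
    have hτi := hS i hiS
    have hql := t.le_end.trans t.end_le
    have hq0 : 0 ≤ q i := by linarith [t.s_lt, c.s_nonneg i]
    have hfq : free w h H s l (q i) ≤ gl := hgl ▸ c.free_mono hql
    have hτl : τ < l + gl := by linarith [t.end_le]
    have hcov : ∀ A ⊆ S, (∀ k ∈ A, h k ≤ H / 2) → ∀ k ∈ A, (s k < q i ∧ q i ≤ s k + w k) ∨
        (q i ≤ s k ∧ s k < r ∧ r < s k + w k ∧ D - w k ≤ τ) := by
      intro A hA hAh k hk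
      have hkS := hS k (hA hk)
      have hs := c.s_nonneg k
      have he := c.end_le k
      have hw := c.w_pos k
      have := hAh k hk
      have := t.end_le
      rcases hσ k with ⟨h1, h2⟩ | ⟨h1, h2⟩
      · linarith
      · rcases h2 with ⟨h2, h3, h4, h5, h6⟩ | ⟨h2, h3, h4, h5⟩ | ⟨h2, h3, h4⟩ | ⟨h2, h3, h4⟩ |
          ⟨h2, h3, h4, h5, h6⟩ | ⟨h2, h3, h4, h5, h6⟩ | ⟨h2, h3, h4, h5, h6⟩ |
          ⟨h2, h3, h4, h5, h6⟩ | ⟨h2, h3, h4, h5, h6⟩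
        · left
          have hqk := hmin k (Finset.mem_filter.2 ⟨hA hk, h2, h4⟩)
          exact ⟨t.lt_of_shifted_lt c h2.s_lt le_rfl (fun _ => h2.tall) (by linarith),
            hqk.trans h2.le_end⟩
        · left
          exact ⟨t.lt_of_shifted_lt c h2 (sh := d) (by rw [← hgl]; exact hle)
            (fun _ => by linarith) (by linarith), by linarith⟩
        · rcases lt_or_ge (s k) (q i) with h5 | h5
          · left; constructor <;> linarith
          · right; refine ⟨h5, ?_, ?_, ?_⟩ <;> linarith
        · exfalso; linarith
        · right; refine ⟨?_, ?_, ?_, ?_⟩ <;> linarith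
        all_goals exfalso; linarith
    refine p.load_le hS (fun i hi => ?_) (fun A hA hAh => ?_) (fun j hj hjt hτ A hA hAh => ?_)
    · rcases hσ i with h1 | h1
      · exact h1.2
      · linarith [h1.1]
    · have := sum_le_add_of_cover (hcov A hA hAh)
        (fun B hB hB' => t.load_before c B fun k hk => ⟨hAh k (hB hk), hB' k hk⟩)
        (fun B hB hB' => c.load_cross_r B fun k hk => ⟨(hB' k hk).2.1, (hB' k hk).2.2.1⟩)
      linarith
    · have hjH : h j ≤ H := by
        simpa using c.load {j} (by simpa using c.w_pos j)
      have := sum_le_add_of_cover (hcov A hA hAh)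
        (fun B hB hB' => t.load_before c B fun k hk => ⟨hAh k (hB hk), hB' k hk⟩)
        (fun B hB hB' => c.load_right_aligned B (τ := τ) (q := q i) (x := h j)
          (fun a ha b hb => (hB' a ha).2.1.trans (hB' b hb).2.2.1)
          (fun k hk => ⟨hAh k (hB hk), by linarith [hB' k hk], (hB' k hk).2.1, (hB' k hk).2.2.2,
            (hB' k hk).1⟩) hq0 hτ
          (fun k hk hqk => t.lt_add_free c (by linarith) hk hqk) hjH)
      linarith
  push Not at hL0
  rcases lt_or_ge τ (l + d) with hτl | hτl
  · have hcov : ∀ A ⊆ S, (∀ k ∈ A, h k ≤ H / 2) → ∀ k ∈ A,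
        (s k < l ∧ l < s k + w k ∧ s k + d ≤ τ) ∨ (s k < r ∧ r < s k + w k) := by
      intro A hA hAh k hk
      have hkS := hS k (hA hk)
      have := hAh k hk
      rcases hσ k with ⟨h1, h2⟩ | ⟨h1, h2⟩
      · linarith
      · rcases h2 with ⟨h2, h3, h4, h5, h6⟩ | ⟨h2, h3, h4, h5⟩ | ⟨h2, h3, h4⟩ | ⟨h2, h3, h4⟩ |
          ⟨h2, h3, h4, h5, h6⟩ | ⟨h2, h3, h4, h5, h6⟩ | ⟨h2, h3, h4, h5, h6⟩ |
          ⟨h2, h3, h4, h5, h6⟩ | ⟨h2, h3, h4, h5, h6⟩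
        · exact absurd h4 (hL0 k (hA hk) h2)
        · left; refine ⟨?_, ?_, ?_⟩ <;> linarith
        · right; constructor <;> linarith
        · exfalso; linarith
        · right; constructor <;> linarith
        · right; constructor <;> linarith
        all_goals exfalso; linarith
    refine p.load_le hS (fun i hi => ?_) (fun A hA hAh => ?_) (fun j hj hjt hτ A hA hAh => ?_)
    · rcases hσ i with h1 | h1
      · exact h1.2
      · linarith [h1.1]
    · have := sum_le_add_of_cover (hcov A hA hAh)
        (fun B hB hB' => c.load_cross_l B fun k hk => ⟨(hB' k hk).1, (hB' k hk).2.1⟩)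
        (fun B hB hB' => c.load_cross_r B fun k hk => ⟨(hB' k hk).1, (hB' k hk).2⟩)
      linarith
    · have hjH : h j ≤ H := by
        simpa using c.load {j} (by simpa using c.w_pos j)
      have := sum_le_add_of_cover (hcov A hA hAh)
        (fun B hB hB' => c.load_shifted B (τ := τ) (d := d) (x := h j)
          (fun k hk => ⟨hAh k (hB hk), hB' k hk⟩) hdR.le hτ hjH)
        (fun B hB hB' => c.load_cross_r B fun k hk => ⟨(hB' k hk).1, (hB' k hk).2⟩)
      linarith
  -- The sorted tall items end by l - gl + d, so none is left from l + d on.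
  have hnt : ∀ k ∈ S, h k ≤ H / 2 := by
    intro k hk
    by_contra! hcon
    have h1 := p.end_le k hcon
    have h2 := hT (h k)
    have h3 := hS k hk
    rcases hσ k with h4 | h4
    · rw [h4.2] at h3; linarith
    · linarith [h4.1]
  rcases lt_or_ge τ (r - 2 * gr - F) with hτr | hτr
  · have := sum_le_add_of_cover (S := S) (h := h) (a := H) (b := H / 2)
      (p := fun k => s k ≤ τ - d ∧ τ - d < s k + w k)
      (q := fun k => s k < r ∧ r < s k + w k) (by
        intro k hk
        have hkS := hS k hk
        have := hnt k hk
        have := c.end_le k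
        rcases hσ k with ⟨h1, h2⟩ | ⟨h1, h2⟩
        · linarith
        · rcases h2 with ⟨h2, h3, h4, h5, h6⟩ | ⟨h2, h3, h4, h5⟩ | ⟨h2, h3, h4⟩ | ⟨h2, h3, h4⟩ |
            ⟨h2, h3, h4, h5, h6⟩ | ⟨h2, h3, h4, h5, h6⟩ | ⟨h2, h3, h4, h5, h6⟩ |
            ⟨h2, h3, h4, h5, h6⟩ | ⟨h2, h3, h4, h5, h6⟩
          · exfalso; linarith
          · left; constructor <;> linarith
          · left; constructor <;> linarith
          · left; constructor <;> linarith
          · right; constructor <;> linarith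
          · right; constructor <;> linarith
          all_goals exfalso; linarith)
      (fun A _ hA' => c.load_at A _ hA') (fun A _ hA' => c.load_cross_r A hA')
    linarith
  -- The items moved left only start from r - 2 · gr - F on. By `hwide`, τ - d is then at least l +
  -- gl + 2 · gr + F, so the right-aligned items across r were packed at τ - d and count towards the
  -- old load there.
  rcases lt_or_ge τ (D - gr) with hτD' | hτD'
  · rcases lt_or_ge τ (D - gr - F) with hτF | hτF
    · have := sum_le_add_of_cover (S := S) (h := h) (a := H) (b := H / 2)
        (p := fun k => s k ≤ τ - d ∧ τ - d < s k + w k)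
        (q := fun k => (LastTouch w h H (DSP.mirror w D s) (D - r) k (q' k) ∧
            σ k = s k - free w h H (DSP.mirror w D s) (D - r) (q' k) - (gr + F)) ∨
          (s k < r ∧ r < s k + w k ∧ σ k = s k - gr - (gr + F))) (by
          intro k hk
          have hkS := hS k hk
          have := hnt k hk
          have := c.end_le k
          rcases hσ k with ⟨h1, h2⟩ | ⟨h1, h2⟩
          · linarith
          · rcases h2 with ⟨h2, h3, h4, h5, h6⟩ | ⟨h2, h3, h4, h5⟩ | ⟨h2, h3, h4⟩ | ⟨h2, h3, h4⟩ |
              ⟨h2, h3, h4, h5, h6⟩ | ⟨h2, h3, h4, h5, h6⟩ | ⟨h2, h3, h4, h5, h6⟩ |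
              ⟨h2, h3, h4, h5, h6⟩ | ⟨h2, h3, h4, h5, h6⟩
            · exfalso; linarith
            · left; constructor <;> linarith
            · left; constructor <;> linarith
            · left; constructor <;> linarith
            · left; constructor <;> linarith
            · right; exact .inr ⟨h3, h4, h6⟩
            · right; exact .inl ⟨h2, h4⟩
            all_goals exfalso; linarith)
        (fun A _ hA' => c.load_at A _ hA') (fun A hA hA' => by
          refine c'.load_stretched (q := q') (sh := fun k => s k - σ k - (gr + F))
            (fun k hk => ⟨hnt k (hA hk), ?_⟩) (fun a ha b hb => ?_)
          · rcases hA' k hk with h1 | h1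
            · exact .inl ⟨h1.1, by linarith [h1.2]⟩
            · right
              rw [← hgr']
              simp only [DSP.mirror]
              refine ⟨?_, ?_, ?_⟩ <;> linarith
          · have h1 := hS a (hA ha)
            have h2 := hS b (hA hb)
            simp only [DSP.mirror]
            linarith)
      linarith
    · have := sum_le_add_of_cover (S := S) (h := h) (a := H) (b := cap)
        (p := fun k => s k ≤ τ - d ∧ τ - d < s k + w k)
        (q := fun k => k ∈ looseLeft w h H s l ∧
          σ k = D - gr - F + f k * gl + free w h H s l (s k)) (by
          intro k hk
          have hkS := hS k hk
          have := hnt k hk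
          have := c.end_le k
          rcases hσ k with ⟨h1, h2⟩ | ⟨h1, h2⟩
          · linarith
          · rcases h2 with ⟨h2, h3, h4, h5, h6⟩ | ⟨h2, h3, h4, h5⟩ | ⟨h2, h3, h4⟩ | ⟨h2, h3, h4⟩ |
              ⟨h2, h3, h4, h5, h6⟩ | ⟨h2, h3, h4, h5, h6⟩ | ⟨h2, h3, h4, h5, h6⟩ |
              ⟨h2, h3, h4, h5, h6⟩ | ⟨h2, h3, h4, h5, h6⟩
            · exfalso; linarith
            · left; constructor <;> linarith
            · left; constructor <;> linarith
            · left; constructor <;> linarith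
            · left; constructor <;> linarith
            · exfalso; linarith
            · exfalso; linarith
            · exfalso; linarith
            · right; exact ⟨h3, h4⟩)
        (fun A _ hA' => c.load_at A _ hA') (fun A hA hA' =>
          c.load_grouped (x := D - gr - F) (τ := τ) (by linarith) hcol fun k hk => by
            have h1 := hS k (hA hk)
            obtain ⟨h2, h3⟩ := hA' k hk
            rw [← hgl]
            refine ⟨h2, ?_, ?_⟩ <;> linarith)
      linarith
  · have := sum_le_add_of_cover (S := S) (h := h) (a := H) (b := H / 2)
      (p := fun k => k ∈ looseLeft w h H (DSP.mirror w D s) (D - r) ∧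
        σ k = D - free w h H (DSP.mirror w D s) (D - r) (DSP.mirror w D s k) - w k)
      (q := fun k => s k < r ∧ r < s k + w k) (by
        intro k hk
        have hkS := hS k hk
        have := hnt k hk
        have := c.end_le k
        rcases hσ k with ⟨h1, h2⟩ | ⟨h1, h2⟩
        · linarith
        · rcases h2 with ⟨h2, h3, h4, h5, h6⟩ | ⟨h2, h3, h4, h5⟩ | ⟨h2, h3, h4⟩ | ⟨h2, h3, h4⟩ |
            ⟨h2, h3, h4, h5, h6⟩ | ⟨h2, h3, h4, h5, h6⟩ | ⟨h2, h3, h4, h5, h6⟩ |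
            ⟨h2, h3, h4, h5, h6⟩ | ⟨h2, h3, h4, h5, h6⟩
          · exfalso; linarith
          · exfalso; linarith
          · right; constructor <;> linarith
          · exfalso; linarith
          · right; constructor <;> linarith
          · right; constructor <;> linarith
          · exfalso; linarith
          · left; exact ⟨h3, h4⟩
          · exfalso; linarith)
      (fun A hA hA' => c'.load_loose_mirrored (τ := τ) fun k hk => by
        have h1 := hS k (hA hk)
        obtain ⟨h2, h3⟩ := hA' k hk
        refine ⟨h2, ?_, ?_⟩ <;> linarith) (fun A _ hA' => c.load_cross_r A hA')
    linarith

/-! ### The case d < gl. -/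

/-- The starting point of an item in the case that the tall items on the right are narrower than
the free part on the left. -/
theorem exists_start_of_lt (c : GapConfig w h D H s l r) {pos q : ι → ℝ} {f : ι → ℕ}
    {gl y : ℝ} (hgl : gl = free w h H s l l)
    (hq : ∀ i, s i + w i ≤ l →
      (∃ j ∈ leftTall w h H s l, s i < s j + w j ∧ s j < s i + w i) → LastTouch w h H s l i (q i))
    (hf : ∀ i, f i < 6) (i : ι) :
    ∃ x : ℝ, (H / 2 < h i ∧ x = pos i) ∨ (h i ≤ H / 2 ∧ (
      (LastTouch w h H s l i (q i) ∧ s i + w i ≤ l ∧ x = s i + free w h H s l (q i) ∧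
        0 ≤ free w h H s l (q i) ∧ free w h H s l (q i) ≤ gl) ∨
      (s i < l ∧ l < s i + w i ∧ s i + w i ≤ D - gl ∧ x = s i + gl) ∨
      (s i < l ∧ l < s i + w i ∧ D - gl < s i + w i ∧ x = D - w i) ∨
      (l ≤ s i ∧ x = s i) ∨
      (s i + w i ≤ l ∧ i ∈ looseLeft w h H s l ∧ x = y + f i * gl + free w h H s l (s i) ∧
        y ≤ x ∧ x + w i ≤ y + 6 * gl))) := by
  have hgl0 : 0 ≤ gl := hgl ▸ c.free_nonneg c.l_nonneg
  rcases lt_or_ge (H / 2) (h i) with hi | hi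
  · exact ⟨_, .inl ⟨hi, rfl⟩⟩
  rcases le_or_gt (s i + w i) l with h1 | h1
  · by_cases ht : ∃ j ∈ leftTall w h H s l, s i < s j + w j ∧ s j < s i + w i
    · have t := hq i h1 ht
      refine ⟨_, .inr ⟨hi, .inl ⟨t, h1, rfl, c.free_nonneg ?_, hgl ▸ c.free_mono ?_⟩⟩⟩
      · linarith [t.s_lt, c.s_nonneg i]
      · linarith [t.le_end]
    · have hm : i ∈ looseLeft w h H s l := mem_looseLeft.2 ⟨hi, h1, fun j hj => by
        by_contra! hcon
        exact ht ⟨j, hj, hcon⟩⟩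
      have h2 := c.free_end_le hm
      have h3 := c.free_nonneg (c.s_nonneg i)
      have h4 : (f i : ℝ) + 1 ≤ 6 := by exact_mod_cast hf i
      have h5 : (0 : ℝ) ≤ f i := Nat.cast_nonneg _
      rw [← hgl] at h2
      refine ⟨_, .inr ⟨hi, .inr (.inr (.inr (.inr ⟨h1, hm, rfl, ?_, ?_⟩)))⟩⟩ <;> nlinarith
  rcases lt_or_ge (s i) l with h2 | h2
  · rcases le_or_gt (s i + w i) (D - gl) with h3 | h3
    · exact ⟨_, .inr ⟨hi, .inr (.inl ⟨h2, h1, h3, rfl⟩)⟩⟩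
    · exact ⟨_, .inr ⟨hi, .inr (.inr (.inl ⟨h2, h1, h3, rfl⟩))⟩⟩
  exact ⟨_, .inr ⟨hi, .inr (.inr (.inr (.inl ⟨h2, rfl⟩)))⟩⟩

-- Items starting at l or later stay, and items across l move right by at most gl. At τ ≥ l the load
-- is thus the old one plus items that are late by at most gl, plus the loose groups inside the
-- window.
open Classical in
theorem exists_packing_of_lt (c : GapConfig w h D H s l r) {pos : ι → ℝ} (p : TallPos w h H pos)
    {f : ι → ℕ} {gl y ε : ℝ} (hε : 0 ≤ ε) (hgl : gl = free w h H s l l)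
    (hlt : ∑ k ∈ rightTall h H s r, w k < gl)
    (hwide : 2 * gl ≤ r - l) (hy : l + gl ≤ y) (hyr : y + 6 * gl ≤ r)
    (hwin : ∀ B : Finset ι, (∀ i ∈ B, (s i < l ∧ l < s i + w i) ∧
      y - gl < s i + w i ∧ s i + w i < y + 6 * gl) → ∑ i ∈ B, h i ≤ ε * H)
    (hf : ∀ i, f i < 6)
    (hcol : ∀ A ⊆ looseLeft w h H s l, (∀ i ∈ A, ∀ k ∈ A, s i < s k + w k) →
      ∀ j, (∀ i ∈ A, f i = j) → ∑ i ∈ A, h i ≤ H / 2) :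
    ∃ σ : ι → ℝ, (∀ i, 0 ≤ σ i ∧ σ i + w i ≤ D) ∧ (∀ i, H / 2 < h i → σ i = pos i) ∧
      ∀ τ, ∀ S : Finset ι, (∀ i ∈ S, σ i ≤ τ ∧ τ < σ i + w i) →
        ∑ i ∈ S, h i ≤ (3 / 2 + ε) * H := by
  obtain ⟨q, hq⟩ := c.exists_lastTouch
  choose σ hσ using c.exists_start_of_lt (pos := pos) (y := y) hgl hq hf
  have hl0 := c.l_nonneg
  have hlr := c.l_lt_r
  have hrD := c.r_le
  have hH := c.H_nonneg
  have hεH := mul_nonneg hε hH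
  have hgl0 : 0 ≤ gl := hgl ▸ c.free_nonneg c.l_nonneg
  have hT : ∀ x : ℝ, ∑ k with H / 2 < h k ∧ x ≤ h k, w k ≤ l := by
    intro x
    rw [c.sum_width_tall]
    have h1 : ∑ k ∈ leftTall w h H s l with x ≤ h k, w k ≤ ∑ k ∈ leftTall w h H s l, w k :=
      Finset.sum_le_sum_of_subset_of_nonneg (Finset.filter_subset _ _) fun k _ _ => (c.w_pos k).le
    have h2 : ∑ k ∈ rightTall h H s r with x ≤ h k, w k ≤ ∑ k ∈ rightTall h H s r, w k :=
      Finset.sum_le_sum_of_subset_of_nonneg (Finset.filter_subset _ _) fun k _ _ => (c.w_pos k).le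
    have h3 := c.free_l
    linarith
  have hσpos : ∀ i, H / 2 < h i → σ i = pos i := fun i hi => by
    rcases hσ i with h1 | h1
    · exact h1.2
    · linarith [h1.1]
  refine ⟨σ, fun i => ?_, hσpos, fun τ S hS => ?_⟩
  · have hs := c.s_nonneg i
    have he := c.end_le i
    have hw := c.w_pos i
    rcases hσ i with ⟨h1, h2⟩ | ⟨h1, h2⟩
    · have h3 := p.nonneg i h1
      have h4 := p.end_le i h1
      have h5 := hT (h i)
      constructor <;> linarith
    · rcases h2 with ⟨h2, h3, h4, h5, h6⟩ | ⟨h2, h3, h4, h5⟩ | ⟨h2, h3, h4, h5⟩ | ⟨h2, h3⟩ |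
        ⟨h2, h3, h4, h5, h6⟩ <;> constructor <;> linarith
  have hjH : ∀ j, h j ≤ H := fun j => by
    simpa using c.load {j} (by simpa using c.w_pos j)
  rcases lt_or_ge τ l with hτl | hτl
  · by_cases hL0 : ∃ i ∈ S, LastTouch w h H s l i (q i) ∧ σ i = s i + free w h H s l (q i)
    · obtain ⟨i, hi, hmin⟩ := Finset.exists_min_image (S.filter fun i =>
        LastTouch w h H s l i (q i) ∧ σ i = s i + free w h H s l (q i)) q (by
          obtain ⟨i, h1, h2⟩ := hL0
          exact ⟨i, Finset.mem_filter.2 ⟨h1, h2⟩⟩)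
      obtain ⟨hiS, t, hσi⟩ := Finset.mem_filter.1 hi
      have hτi := hS i hiS
      have hql := t.le_end.trans t.end_le
      have hq0 : 0 ≤ q i := by linarith [t.s_lt, c.s_nonneg i]
      have hcov : ∀ A ⊆ S, (∀ k ∈ A, h k ≤ H / 2) → ∀ k ∈ A, (s k < q i ∧ q i ≤ s k + w k) ∨
          (q i ≤ s k ∧ s k < l ∧ l < s k + w k ∧ D - w k ≤ τ) := by
        intro A hA hAh k hk
        have hkS := hS k (hA hk)
        have := hAh k hk
        have := t.end_le
        rcases hσ k with ⟨h1, h2⟩ | ⟨h1, h2⟩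
        · linarith
        · rcases h2 with ⟨h2, h3, h4, h5, h6⟩ | ⟨h2, h3, h4, h5⟩ | ⟨h2, h3, h4, h5⟩ | ⟨h2, h3⟩ |
            ⟨h2, h3, h4, h5, h6⟩
          · left
            have hqk := hmin k (Finset.mem_filter.2 ⟨hA hk, h2, h4⟩)
            exact ⟨t.lt_of_shifted_lt c h2.s_lt le_rfl (fun _ => h2.tall) (by linarith),
              hqk.trans h2.le_end⟩
          · left
            exact ⟨t.lt_of_shifted_lt c h2 (sh := gl) hgl.ge
              (fun _ => by linarith) (by linarith), by linarith⟩
          · rcases lt_or_ge (s k) (q i) with h6 | h6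
            · left; constructor <;> linarith
            · right; refine ⟨h6, ?_, ?_, ?_⟩ <;> linarith
          · exfalso; linarith
          · exfalso; linarith
      refine p.load_le hS hσpos (fun A hA hAh => ?_) (fun j hj hjt hτ A hA hAh => ?_)
      · have := sum_le_add_of_cover (hcov A hA hAh)
          (fun B hB hB' => t.load_before c B fun k hk => ⟨hAh k (hB hk), hB' k hk⟩)
          (fun B hB hB' => c.load_cross_l B fun k hk => ⟨(hB' k hk).2.1, (hB' k hk).2.2.1⟩)
        linarith
      · have := sum_le_add_of_cover (hcov A hA hAh)
          (fun B hB hB' => t.load_before c B fun k hk => ⟨hAh k (hB hk), hB' k hk⟩)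
          (fun B hB hB' => c.load_right_aligned B (τ := τ) (q := q i) (x := h j)
            (fun a ha b hb => (hB' a ha).2.1.trans (hB' b hb).2.2.1)
            (fun k hk => ⟨hAh k (hB hk), (hB' k hk).2.2.1, by linarith [hB' k hk],
              (hB' k hk).2.2.2, (hB' k hk).1⟩) hq0 hτ
            (fun k hk hqk => t.lt_add_free c (by linarith) hk hqk) (hjH j))
        linarith
    push Not at hL0
    have hcov : ∀ A ⊆ S, (∀ k ∈ A, h k ≤ H / 2) → ∑ k ∈ A, h k ≤ H / 2 := by
      intro A hA hAh
      refine c.load_cross_l A fun k hk => ?_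
      have hkS := hS k (hA hk)
      have := hAh k hk
      rcases hσ k with ⟨h1, h2⟩ | ⟨h1, h2⟩
      · linarith
      · rcases h2 with ⟨h2, h3, h4, h5, h6⟩ | ⟨h2, h3, h4, h5⟩ | ⟨h2, h3, h4, h5⟩ | ⟨h2, h3⟩ |
          ⟨h2, h3, h4, h5, h6⟩
        · exact absurd h4 (hL0 k (hA hk) h2)
        · exact ⟨h2, h3⟩
        · exact ⟨h2, h3⟩
        · exfalso; linarith
        · exfalso; linarith
    refine p.load_le hS hσpos (fun A hA hAh => ?_) (fun j hj hjt hτ A hA hAh => ?_)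
    · linarith [hcov A hA hAh]
    · linarith [hcov A hA hAh, hjH j]
  have hnt : ∀ k ∈ S, h k ≤ H / 2 := by
    intro k hk
    by_contra! hcon
    have h1 := p.end_le k hcon
    have h2 := hT (h k)
    have h3 := hS k hk
    rw [hσpos k hcon] at h3
    linarith
  -- A delayed item is present only before l + gl, which precedes the window. The items across l
  -- that move by exactly gl were then packed at the smallest contact point, and count towards its
  -- H/2.
  by_cases hL0 : ∃ i ∈ S, LastTouch w h H s l i (q i) ∧ σ i = s i + free w h H s l (q i)
  · obtain ⟨i, hi, hmin⟩ := Finset.exists_min_image (S.filter fun i =>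
      LastTouch w h H s l i (q i) ∧ σ i = s i + free w h H s l (q i)) q (by
        obtain ⟨i, h1, h2⟩ := hL0
        exact ⟨i, Finset.mem_filter.2 ⟨h1, h2⟩⟩)
    obtain ⟨hiS, t, hσi⟩ := Finset.mem_filter.1 hi
    have hτi := hS i hiS
    have hql := t.le_end.trans t.end_le
    have hfq : free w h H s l (q i) ≤ gl := hgl ▸ c.free_mono hql
    have hτl' : τ < l + gl := by linarith [t.end_le]
    have := sum_le_add_of_cover (S := S) (h := h) (a := H / 2) (b := H)
      (p := fun k => s k < q i ∧ q i ≤ s k + w k)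
      (q := fun k => s k ≤ τ ∧ τ < s k + w k) (by
        intro k hk
        have hkS := hS k hk
        have := hnt k hk
        have := t.end_le
        rcases hσ k with ⟨h1, h2⟩ | ⟨h1, h2⟩
        · linarith
        · rcases h2 with ⟨h2, h3, h4, h5, h6⟩ | ⟨h2, h3, h4, h5⟩ | ⟨h2, h3, h4, h5⟩ | ⟨h2, h3⟩ |
            ⟨h2, h3, h4, h5, h6⟩
          · left
            have hqk := hmin k (Finset.mem_filter.2 ⟨hk, h2, h4⟩)
            exact ⟨t.lt_of_shifted_lt c h2.s_lt le_rfl (fun _ => h2.tall) (by linarith),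
              hqk.trans h2.le_end⟩
          · left
            exact ⟨t.lt_of_shifted_lt c h2 (sh := gl) hgl.ge
              (fun _ => by linarith) (by linarith), by linarith⟩
          · right; constructor <;> linarith
          · right; constructor <;> linarith
          · exfalso; linarith)
      (fun A hA hA' => t.load_before c A fun k hk => ⟨hnt k (hA hk), hA' k hk⟩)
      (fun A _ hA' => c.load_at A _ hA')
    linarith
  push Not at hL0
  have hcov : ∀ k ∈ S, (s k ≤ τ ∧ τ < s k + w k) ∨
      ((s k < l ∧ l < s k + w k ∧ s k + w k ≤ τ ∧ τ < s k + w k + gl) ∨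
      (k ∈ looseLeft w h H s l ∧ σ k = y + f k * gl + free w h H s l (s k) ∧
        y ≤ τ ∧ τ < y + 6 * gl)) := by
    intro k hk
    have hkS := hS k hk
    have := hnt k hk
    have := c.end_le k
    rcases hσ k with ⟨h1, h2⟩ | ⟨h1, h2⟩
    · linarith
    · rcases h2 with ⟨h2, h3, h4, h5, h6⟩ | ⟨h2, h3, h4, h5⟩ | ⟨h2, h3, h4, h5⟩ | ⟨h2, h3⟩ |
        ⟨h2, h3, h4, h5, h6⟩
      · exact absurd h4 (hL0 k hk h2)
      · rcases lt_or_ge τ (s k + w k) with h6 | h6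
        · left; constructor <;> linarith
        · right; left; refine ⟨?_, ?_, ?_, ?_⟩ <;> linarith
      · rcases lt_or_ge τ (s k + w k) with h6 | h6
        · left; constructor <;> linarith
        · right; left; refine ⟨?_, ?_, ?_, ?_⟩ <;> linarith
      · left; constructor <;> linarith
      · right; right; refine ⟨h3, h4, ?_, ?_⟩ <;> linarith
  -- Inside the window the late items ended after y - gl and weigh at most εH by `hwin`, and a loose
  -- group adds H/2. Outside, the late items alone are bounded by H/2.
  by_cases hwy : y ≤ τ ∧ τ < y + 6 * gl
  · have := sum_le_add_of_cover (h := h) (a := H) (b := ε * H + H / 2) hcov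
      (fun A _ hA' => c.load_at A _ hA') (fun A hA hA' => sum_le_add_of_cover hA'
        (fun B _ hB' => hwin B fun k hk => by
          obtain ⟨h1, h2, h3, h4⟩ := hB' k hk
          refine ⟨⟨h1, h2⟩, ?_, ?_⟩ <;> linarith)
        (fun B hB hB' => c.load_grouped (x := y) (τ := τ) (by linarith) hcol fun k hk => by
            have h1 := hS k (hA (hB hk))
            obtain ⟨h2, h3, -, -⟩ := hB' k hk
            rw [← hgl]
            refine ⟨h2, ?_, ?_⟩ <;> linarith))
    linarith
  · have := sum_le_add_of_cover (h := h) (a := H) (b := H / 2) hcov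
      (fun A _ hA' => c.load_at A _ hA') (fun A hA hA' => c.load_cross_l A fun k hk => by
        rcases hA' k hk with h1 | h1
        · exact ⟨h1.1, h1.2.1⟩
        · exact absurd h1.2.2 hwy)
    linarith

/-! ### Choice of the number of groups and windows. -/

/-- The two cases together. -/
theorem exists_packing (c : GapConfig w h D H s l r) {pos : ι → ℝ} (p : TallPos w h H pos)
    {ε lam : ℝ} (hε : 0 < ε) (hlam : lam ≤ ε / (3 * (5 + 4 * ε))) (hlam' : lam ≤ 1 / 60)
    (hwide : (1 / 2 - 3 * lam) * D ≤ r - l) (hlr : D - r ≤ l)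
    (hleft : l - ∑ k ∈ leftTall w h H s l, w k ≤ lam * D)
    (hright : D - r - ∑ k ∈ rightTall h H s r, w k ≤ lam * D) :
    ∃ σ : ι → ℝ, (∀ i, 0 ≤ σ i ∧ σ i + w i ≤ D) ∧ (∀ i, H / 2 < h i → σ i = pos i) ∧
      ∀ τ, ∀ S : Finset ι, (∀ i ∈ S, σ i ≤ τ ∧ τ < σ i + w i) →
        ∑ i ∈ S, h i ≤ (3 / 2 + ε) * H := by
  classical
  have hH := c.H_nonneg
  have hl0 := c.l_nonneg
  have hrD := c.r_le
  have hDpos : 0 < D := by linarith [c.l_lt_r]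
  have hloose : ∀ i ∈ looseLeft w h H s l, h i ≤ H / 2 := fun i hi => (mem_looseLeft.1 hi).1
  obtain ⟨gl, hgl⟩ : ∃ gl, gl = free w h H s l l := ⟨_, rfl⟩
  obtain ⟨gr, hgr⟩ : ∃ gr, gr = D - r - ∑ k ∈ rightTall h H s r, w k := ⟨_, rfl⟩
  have hgl0 : 0 ≤ gl := hgl ▸ c.free_nonneg c.l_nonneg
  have hgl1 : gl ≤ lam * D := by rw [hgl, c.free_l]; exact hleft
  rw [← hgr] at hright
  have hlamε : lam * (15 + 12 * ε) ≤ ε := by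
    rw [le_div_iff₀ (by positivity)] at hlam
    linarith
  have hlD : lam * D ≤ 1 / 60 * D := mul_le_mul_of_nonneg_right hlam' hDpos.le
  rcases le_or_gt gl (∑ k ∈ rightTall h H s r, w k) with hle | hlt
  -- For ε ≥ 1/6 a group may carry (1/2 + ε)H ≥ 2H/3, and three groups suffice; otherwise six are
  -- used. As D - r ≤ l, the gap exceeds D - r by at least (1/4 - 9λ/2)D. This must cover (4 + 2n)λD
  -- for n groups, so λ ≤ 1/58 suffices for three and λ ≤ 1/82 for six.
  · rcases le_or_gt (1 / 6) ε with h6 | h6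
    · obtain ⟨f, hf, hcol⟩ := exists_coloring_three c.load c.w_pos c.h_nonneg ((1 / 2 + ε) * H)
        (by nlinarith) (looseLeft w h H s l) hloose
      obtain ⟨σ, h1, h2, h3⟩ := c.exists_packing_of_le p hgl hgr hle
        (by push_cast; linarith) (by nlinarith) hf hcol
      refine ⟨σ, h1, h2, fun τ S hS => (h3 τ S hS).trans (by linarith)⟩
    · obtain ⟨f, hf, hcol⟩ := exists_coloring_six c.load c.w_pos c.h_nonneg
        (looseLeft w h H s l) hloose
      have hlam2 : lam ≤ 1 / 90 := by
        by_contra! hcon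
        nlinarith
      have hlD : lam * D ≤ 1 / 90 * D := mul_le_mul_of_nonneg_right hlam2 hDpos.le
      obtain ⟨σ, h1, h2, h3⟩ := c.exists_packing_of_le p hgl hgr hle
        (by push_cast; linarith) le_rfl hf hcol
      refine ⟨σ, h1, h2, fun τ S hS => (h3 τ S hS).trans ?_⟩
      nlinarith
  · obtain ⟨f, hf, hcol⟩ := exists_coloring_six c.load c.w_pos c.h_nonneg
        (looseLeft w h H s l) hloose
    obtain ⟨n, hn⟩ : ∃ n : ℕ, n = ⌈1 / (2 * ε)⌉₊ := ⟨_, rfl⟩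
    have hn1 : 1 / (2 * ε) ≤ n := hn ▸ Nat.le_ceil _
    have hn2 : (n : ℝ) < 1 / (2 * ε) + 1 := hn ▸ Nat.ceil_lt_add_one (by positivity)
    have hn0 : 0 < n := hn ▸ Nat.ceil_pos.2 (by positivity)
    have hnε : 1 ≤ 2 * ε * n := by
      rw [div_le_iff₀ (by positivity)] at hn1
      linarith
    have hnε' : 2 * ε * n < 1 + 2 * ε := by
      have := mul_lt_mul_of_pos_left hn2 (show 0 < 2 * ε by positivity)
      rwa [mul_add, mul_one_div_cancel (by positivity), mul_one] at this
    have hlam0 : 0 ≤ lam := by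
      by_contra! hcon
      nlinarith
    -- For ε ≤ 1 the bound n < 1/(2ε) + 1 reduces this to λ(7 + 20ε) ≤ ε, which follows from 7 + 20ε
    -- ≤ 15 + 12ε. For ε > 1 there is one window, and λ ≤ 1/60 suffices.
    have hnlam : 7 * n * lam ≤ 1 / 2 - 3 * lam := by
      rcases le_or_gt ε 1 with h1 | h1
      · have h2 : ε * (7 * n * lam) ≤ ε * (1 / 2 - 3 * lam) := by nlinarith
        exact le_of_mul_le_mul_left h2 hε
      · have : n ≤ 1 := by
          have h2 : (n : ℝ) < 2 := by
            by_contra! hcon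
            nlinarith
          have : n < 2 := by exact_mod_cast h2
          omega
        have : (n : ℝ) ≤ 1 := by exact_mod_cast this
        nlinarith
    have hfit : n * (7 * gl) ≤ r - l := by
      have h1 : (n : ℝ) * (7 * gl) ≤ n * (7 * (lam * D)) :=
        mul_le_mul_of_nonneg_left (by linarith) (Nat.cast_nonneg _)
      have h2 := mul_le_mul_of_nonneg_right hnlam hDpos.le
      linarith
    obtain ⟨m, hm, hwin⟩ := exists_window c.h_nonneg
      (Finset.univ.filter fun i => s i < l ∧ l < s i + w i) (fun i => s i + w i) n hn0 l (7 * gl)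
      (by linarith)
    have hm1 : (m : ℝ) + 1 ≤ n := by exact_mod_cast hm
    have hm0 : (0 : ℝ) ≤ m := Nat.cast_nonneg _
    have hcr := c.load_cross_l (Finset.univ.filter fun i => s i < l ∧ l < s i + w i) (by simp)
    have hmn : ((m : ℝ) + 1) * (7 * gl) ≤ n * (7 * gl) :=
      mul_le_mul_of_nonneg_right hm1 (by linarith)
    -- Windows have width 7 · gl: six groups of width gl, preceded by a margin gl, since items
    -- across l can be late by gl.
    refine c.exists_packing_of_lt p (f := f) (y := l + m * (7 * gl) + gl) hε.le hgl hlt ?_ ?_ ?_ ?_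
      hf hcol
    · linarith
    · have := mul_nonneg hm0 (show 0 ≤ 7 * gl by linarith)
      linarith
    · linarith
    · intro B hB
      have h1 := hwin B (fun i hi => by simpa using (hB i hi).1) (fun i hi => by
        have := (hB i hi).2
        constructor <;> linarith)
      have h2 : 0 ≤ ∑ i ∈ B, h i := Finset.sum_nonneg fun i _ => c.h_nonneg i
      nlinarith

end GapConfig

end

/-! ### From instances and gaps to `GapConfig`. -/

section

variable {ι : Type*} [Fintype ι]

/-- The tall items can be packed side by side in non-increasing order of height. -/
theorem exists_tallPos (I : Instance ι) (H : ℝ) :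
    ∃ pos : ι → ℝ, TallPos (fun i => (I.w i : ℝ)) (fun i => (I.h i : ℝ)) H pos ∧
      ∀ σ : ι → ℝ, (∀ i, H / 2 < I.h i → σ i = pos i) → TallSorted I H σ := by
  classical
  obtain ⟨n, e, he⟩ : ∃ (n : ℕ) (e : Fin n ≃ {i // IsTall I H i}),
      ∀ a b : Fin n, a ≤ b → I.h (e b).1 ≤ I.h (e a).1 := by
    let e₀ := Fintype.equivFin {i // IsTall I H i}
    -- Heights are negated because `Tuple.sort` sorts in increasing order.
    let g : Fin _ → ℤ := fun a => -(I.h (e₀.symm a).1 : ℤ)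
    refine ⟨_, (Tuple.sort g).trans e₀.symm, fun a b hab => ?_⟩
    have h : -(I.h (e₀.symm (Tuple.sort g a)).1 : ℤ) ≤ -(I.h (e₀.symm (Tuple.sort g b)).1 : ℤ) :=
      Tuple.monotone_sort g hab
    exact_mod_cast neg_le_neg_iff.1 h
  let P : Fin n → ℝ := fun a => ∑ b ∈ Finset.Iio a, (I.w (e b).1 : ℝ)
  have hP : ∀ a, P a + I.w (e a).1 = ∑ b ∈ Finset.Iic a, (I.w (e b).1 : ℝ) := by
    intro a
    rw [← Finset.Iio_insert, Finset.sum_insert (by simp), add_comm]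
  have hlt : ∀ a b, a < b → P a + I.w (e a).1 ≤ P b := by
    intro a b hab
    rw [hP]
    refine Finset.sum_le_sum_of_subset_of_nonneg (fun k hk => ?_) fun _ _ _ => Nat.cast_nonneg _
    rw [Finset.mem_Iic] at hk
    exact Finset.mem_Iio.2 (hk.trans_lt hab)
  refine ⟨fun i => if hi : IsTall I H i then P (e.symm ⟨i, hi⟩) else 0, ⟨?_, ?_, ?_⟩, ?_⟩
  · intro i hi
    change IsTall I H i at hi
    simp only [hi, dif_pos]
    exact Finset.sum_nonneg fun _ _ => Nat.cast_nonneg _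
  · intro i hi
    change IsTall I H i at hi
    simp only [hi, dif_pos]
    obtain ⟨a, ha⟩ : ∃ a, a = e.symm ⟨i, hi⟩ := ⟨_, rfl⟩
    have hai : (e a).1 = i := by rw [ha]; simp
    rw [← ha]
    have h1 := hP a
    rw [hai] at h1
    rw [h1, ← Finset.sum_image (s := Finset.Iic a) (f := fun k => (I.w k : ℝ))
      (g := fun b => (e b).1) (fun b _ b' _ h => e.injective (Subtype.ext h))]
    refine Finset.sum_le_sum_of_subset_of_nonneg (fun k hk => ?_) fun _ _ _ => Nat.cast_nonneg _
    obtain ⟨b, hb, rfl⟩ := Finset.mem_image.1 hk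
    refine Finset.mem_filter.2 ⟨Finset.mem_univ _, (e b).2, ?_⟩
    have := he b a (Finset.mem_Iic.1 hb)
    rw [hai] at this
    exact_mod_cast this
  · intro i k hi hk hik
    change IsTall I H i at hi
    change IsTall I H k at hk
    simp only [hi, hk, dif_pos]
    have h1 := hlt (e.symm ⟨i, hi⟩) (e.symm ⟨k, hk⟩)
    have h2 := hlt (e.symm ⟨k, hk⟩) (e.symm ⟨i, hi⟩)
    simp only [Equiv.apply_symm_apply] at h1 h2
    rcases lt_trichotomy (e.symm ⟨i, hi⟩) (e.symm ⟨k, hk⟩) with h | h | h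
    · exact .inl (h1 h)
    · exact absurd (congrArg Subtype.val (e.symm.injective h)) hik
    · exact .inr (h2 h)
  · intro σ hσ
    refine ⟨n, e, he, fun a => ?_⟩
    rw [hσ _ (e a).2]
    simp only [(e a).2, dif_pos]
    simp [P]

variable {I : Instance ι} {H : ℝ} {σ : ι → ℝ} {l r : ℝ}

/-- A point at which no tall item is packed lies in a gap, which is bounded by tall items. -/
theorem exists_isGap (I : Instance ι) (H : ℝ) (σ : ι → ℝ) {x : ℝ} (hx0 : 0 ≤ x) (hxD : x < I.D)
    (hx : ∀ i, IsTall I H i → ¬ PackedAt I σ i x) :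
    ∃ l r, IsGap I H σ l r ∧ l ≤ x ∧ x < r ∧
      (0 < l → ∃ i, IsTall I H i ∧ σ i + I.w i = l) ∧
      (r < I.D → ∃ i, IsTall I H i ∧ σ i = r) := by
  classical
  -- The gap around x runs from the last end of a tall item up to x, or 0, to the first start of a
  -- tall item after x, or D.
  let E : Finset ℝ := insert 0
    ((Finset.univ.filter fun i => IsTall I H i ∧ σ i + I.w i ≤ x).image fun i => σ i + I.w i)
  let B : Finset ℝ := insert (I.D : ℝ) ((Finset.univ.filter fun i => IsTall I H i ∧ x < σ i).image σ)
  have hE : E.Nonempty := ⟨0, Finset.mem_insert_self _ _⟩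
  have hB : B.Nonempty := ⟨I.D, Finset.mem_insert_self _ _⟩
  obtain ⟨l, hl⟩ : ∃ l, l = E.max' hE := ⟨_, rfl⟩
  obtain ⟨r, hr⟩ : ∃ r, r = B.min' hB := ⟨_, rfl⟩
  have hlE : l ∈ E := hl ▸ E.max'_mem hE
  have hrB : r ∈ B := hr ▸ B.min'_mem hB
  have hl0 : 0 ≤ l := hl ▸ E.le_max' 0 (Finset.mem_insert_self _ _)
  have hrD : r ≤ I.D := hr ▸ B.min'_le _ (Finset.mem_insert_self _ _)
  have hl' : l = 0 ∨ ∃ i, IsTall I H i ∧ σ i + I.w i = l ∧ l ≤ x := by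
    rcases Finset.mem_insert.1 hlE with h | h
    · exact .inl h
    · obtain ⟨i, hi, h⟩ := Finset.mem_image.1 h
      obtain ⟨-, h1, h2⟩ := Finset.mem_filter.1 hi
      exact .inr ⟨i, h1, h, h ▸ h2⟩
  have hr' : r = I.D ∨ ∃ i, IsTall I H i ∧ σ i = r ∧ x < r := by
    rcases Finset.mem_insert.1 hrB with h | h
    · exact .inl h
    · obtain ⟨i, hi, h⟩ := Finset.mem_image.1 h
      obtain ⟨-, h1, h2⟩ := Finset.mem_filter.1 hi
      exact .inr ⟨i, h1, h, h ▸ h2⟩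
  have hlx : l ≤ x := by
    rcases hl' with h | ⟨-, -, -, h⟩
    · rw [h]; exact hx0
    · exact h
  have hxr : x < r := by
    rcases hr' with h | ⟨-, -, -, h⟩
    · rw [h]; exact hxD
    · exact h
  refine ⟨l, r, ⟨hl0, hlx.trans_lt hxr, hrD, ?_, ?_⟩, hlx, hxr, fun h => ?_, fun h => ?_⟩
  · intro i hi t ht hp
    rcases le_or_gt (σ i + I.w i) x with h1 | h1
    · have : σ i + I.w i ≤ l := hl ▸ E.le_max' _ (Finset.mem_insert_of_mem
        (Finset.mem_image_of_mem _ (Finset.mem_filter.2 ⟨Finset.mem_univ _, hi, h1⟩)))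
      linarith [ht.1, hp.2]
    · rcases lt_or_ge x (σ i) with h2 | h2
      · have : r ≤ σ i := hr ▸ B.min'_le _ (Finset.mem_insert_of_mem
          (Finset.mem_image_of_mem _ (Finset.mem_filter.2 ⟨Finset.mem_univ _, hi, h2⟩)))
        linarith [ht.2, hp.1]
      · exact hx i hi ⟨h2, h1⟩
  · intro l' r' h0 hll hrr hD hfree
    constructor
    · rcases hl' with h | ⟨i, hi, hil, -⟩
      · linarith
      · by_contra hne
        have hlt : l' < l := lt_of_le_of_ne hll hne
        have hw : (0 : ℝ) < I.w i := Nat.cast_pos.2 (I.w_pos i)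
        have hm : max l' (σ i) < l := max_lt hlt (by linarith)
        exact hfree i hi (max l' (σ i)) ⟨le_max_left _ _, by linarith⟩
          ⟨le_max_right _ _, by linarith⟩
    · rcases hr' with h | ⟨i, hi, hir, -⟩
      · linarith
      · by_contra hne
        have hlt : r < r' := lt_of_le_of_ne hrr (Ne.symm hne)
        have hw : (0 : ℝ) < I.w i := Nat.cast_pos.2 (I.w_pos i)
        exact hfree i hi r ⟨by linarith, hlt⟩ ⟨hir.le, by linarith⟩
  · rcases hl' with h1 | ⟨i, hi, h1, -⟩
    · linarith
    · exact ⟨i, hi, h1⟩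
  · rcases hr' with h1 | ⟨i, hi, h1, -⟩
    · linarith
    · exact ⟨i, hi, h1⟩

/-- Gaps that meet are equal. -/
theorem IsGap.eq_of_lt (hg : IsGap I H σ l r) {l' r' : ℝ} (hg' : IsGap I H σ l' r')
    (h1 : l < r') (h2 : l' < r) : l = l' ∧ r = r' := by
  obtain ⟨a1, a2, a3, a4, a5⟩ := hg
  obtain ⟨b1, b2, b3, b4, b5⟩ := hg'
  have hfree : TallFree I H σ (min l l') (max r r') := by
    intro i hi t ht hp
    rcases lt_or_ge t r with h3 | h3
    · rcases le_or_gt l t with h4 | h4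
      · exact a4 i hi t ⟨h4, h3⟩ hp
      · exact b4 i hi t ⟨(min_le_iff.1 ht.1).resolve_left (by linarith), by linarith⟩ hp
    · exact b4 i hi t ⟨by linarith, (lt_max_iff.1 ht.2).resolve_left (by linarith)⟩ hp
  have h3 := a5 _ _ (le_min a1 b1) (min_le_left _ _) (le_max_left _ _) (max_le a3 b3) hfree
  have h4 := b5 _ _ (le_min a1 b1) (min_le_right _ _) (le_max_right _ _) (max_le a3 b3) hfree
  exact ⟨h3.1.symm.trans h4.1, h3.2.symm.trans h4.2⟩

theorem IsGap.gapConfig (hσ : IsOptimal I σ) (hg : IsGap I (opt I) σ l r) :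
    GapConfig (fun i => (I.w i : ℝ)) (fun i => (I.h i : ℝ)) I.D (opt I) σ l r := by
  classical
  have hw : ∀ i, (0 : ℝ) < I.w i := fun i => Nat.cast_pos.2 (I.w_pos i)
  have hend : ∀ i, σ i + I.w i ≤ I.D := fun i => by linarith [(hσ.1 i).2]
  have hgap := hg
  obtain ⟨hl0, hlr, hrD, hfree, -⟩ := hgap
  -- The gap constructed around l comes with its bounding tall items, and it coincides with the
  -- given gap because the two meet.
  obtain ⟨l', r', hg', h1, h2, h3, h4⟩ := exists_isGap I (opt I) σ hl0 (hlr.trans_le hrD)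
    (fun i hi => hfree i hi l ⟨le_rfl, hlr⟩)
  obtain ⟨rfl, rfl⟩ := hg.eq_of_lt hg' h2 (h1.trans_lt hlr)
  refine ⟨hw, fun i => Nat.cast_nonneg _, fun i => (hσ.1 i).1, hend, fun S hS => ?_, hl0, hlr, hrD,
    fun i hi => ?_, h3, h4⟩
  · rcases S.eq_empty_or_nonempty with rfl | hne
    · simp
    obtain ⟨i, hi, hmax⟩ := Finset.exists_max_image S σ hne
    have h5 : heightAt I σ (σ i) ≤ opt I := by
      rw [← hσ.height_eq_opt]
      exact (height_isGreatest I σ).2 ⟨σ i, ⟨(hσ.1 i).1, by linarith [hend i, hw i]⟩, rfl⟩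
    have h6 : ∑ k ∈ S, I.h k ≤ heightAt I σ (σ i) :=
      Finset.sum_le_sum_of_subset fun k hk =>
        Finset.mem_filter.2 ⟨Finset.mem_univ _, hmax k hk, hS i hi k hk⟩
    exact_mod_cast h6.trans h5
  · by_contra! hcon
    refine hfree i hi (max l (σ i)) ⟨le_max_left _ _, max_lt hlr hcon.2⟩
      ⟨le_max_right _ _, max_lt hcon.1 (by linarith [hw i])⟩

/-- Intervals that cover an interval have at least its length. -/
theorem length_le_of_cover {s w : ι → ℝ} (hw : ∀ i, 0 < w i) (J : Finset ι) (G : Finset (ℝ × ℝ))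
    (hG : ∀ p ∈ G, p.1 ≤ p.2) {a b : ℝ} (hab : a ≤ b)
    (hcov : ∀ x, a ≤ x → x < b → (∃ j ∈ J, s j ≤ x ∧ x < s j + w j) ∨
      ∃ p ∈ G, p.1 ≤ x ∧ x < p.2) :
    b - a ≤ ∑ j ∈ J, w j + ∑ p ∈ G, (p.2 - p.1) := by
  have h1 : MeasureTheory.volume.real (Set.Ico a b) ≤ MeasureTheory.volume.real
      ((⋃ j ∈ J, Set.Ico (s j) (s j + w j)) ∪ ⋃ p ∈ G, Set.Ico p.1 p.2) := by
    refine MeasureTheory.measureReal_mono (fun x hx => ?_) ?_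
    · rcases hcov x hx.1 hx.2 with ⟨j, hj, h⟩ | ⟨p, hp, h⟩
      · exact .inl (Set.mem_biUnion hj h)
      · exact .inr (Set.mem_biUnion hp h)
    · refine (MeasureTheory.measure_union_lt_top ?_ ?_).ne <;>
      exact (MeasureTheory.measure_biUnion_lt_top (Finset.finite_toSet _)
        fun _ _ => measure_Ico_lt_top)
  have h2 := MeasureTheory.measureReal_union_le (μ := MeasureTheory.volume)
    (⋃ j ∈ J, Set.Ico (s j) (s j + w j)) (⋃ p ∈ G, Set.Ico p.1 p.2)
  have h3 := MeasureTheory.measureReal_biUnion_finset_le (μ := MeasureTheory.volume) J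
    (fun j => Set.Ico (s j) (s j + w j))
  have h4 := MeasureTheory.measureReal_biUnion_finset_le (μ := MeasureTheory.volume) G
    (fun p => Set.Ico p.1 p.2)
  rw [Real.volume_real_Ico_of_le hab] at h1
  have h5 : ∑ j ∈ J, MeasureTheory.volume.real (Set.Ico (s j) (s j + w j)) = ∑ j ∈ J, w j :=
    Finset.sum_congr rfl fun j _ => by
      rw [Real.volume_real_Ico_of_le (by linarith [hw j])]; ring
  have h6 : ∑ p ∈ G, MeasureTheory.volume.real (Set.Ico p.1 p.2) = ∑ p ∈ G, (p.2 - p.1) :=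
    Finset.sum_congr rfl fun p hp => Real.volume_real_Ico_of_le (hG p hp)
  linarith

/-- Each point of [0, l) lies in a tall item ending by l or in a gap ending by l, so the lengths of
these add up to at least l. -/
theorem IsGap.sub_sum_le_gapWidthLeft (hσ : IsOptimal I σ) (hg : IsGap I (opt I) σ l r) :
    l - ∑ k ∈ leftTall (fun i => (I.w i : ℝ)) (fun i => (I.h i : ℝ)) (opt I) σ l, (I.w k : ℝ) ≤
      gapWidthLeft I (opt I) σ l := by
  have c := hg.gapConfig hσ
  have hfin : {p : ℝ × ℝ | IsGap I (opt I) σ p.1 p.2 ∧ p.2 ≤ l}.Finite :=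
    (finite_setOf_isGap I (opt I) σ).subset fun p hp => hp.1
  unfold gapWidthLeft
  rw [finsum_mem_eq_finite_toFinset_sum _ hfin]
  have := length_le_of_cover (s := σ) c.w_pos
    (leftTall (fun i => (I.w i : ℝ)) (fun i => (I.h i : ℝ)) (opt I) σ l) hfin.toFinset
    (fun p hp => ((Set.Finite.mem_toFinset hfin).1 hp).1.2.1.le) c.l_nonneg (fun x h0 hx => by
      have hlr := c.l_lt_r
      have hrD := c.r_le
      by_cases ht : ∃ j, IsTall I (opt I) j ∧ PackedAt I σ j x
      · obtain ⟨j, hj, hp⟩ := ht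
        refine .inl ⟨j, mem_leftTall.2 ⟨hj, (c.tall_side j hj).resolve_right fun h => ?_⟩, hp⟩
        linarith [hp.1]
      · push Not at ht
        obtain ⟨l', r', hg', h1, h2, -, -⟩ := exists_isGap I (opt I) σ h0 (by linarith) ht
        refine .inr ⟨(l', r'), (Set.Finite.mem_toFinset hfin).2 ⟨hg', ?_⟩, h1, h2⟩
        by_contra! hcon
        have := (hg.eq_of_lt hg' hcon (by linarith)).1
        linarith)
  linarith

theorem IsGap.sub_sum_le_gapWidthRight (hσ : IsOptimal I σ) (hg : IsGap I (opt I) σ l r) :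
    I.D - r - ∑ k ∈ rightTall (fun i => (I.h i : ℝ)) (opt I) σ r, (I.w k : ℝ) ≤
      gapWidthRight I (opt I) σ r := by
  have c := hg.gapConfig hσ
  have hfin : {p : ℝ × ℝ | IsGap I (opt I) σ p.1 p.2 ∧ r ≤ p.1}.Finite :=
    (finite_setOf_isGap I (opt I) σ).subset fun p hp => hp.1
  unfold gapWidthRight
  rw [finsum_mem_eq_finite_toFinset_sum _ hfin]
  have := length_le_of_cover (s := σ) c.w_pos
    (rightTall (fun i => (I.h i : ℝ)) (opt I) σ r) hfin.toFinset
    (fun p hp => ((Set.Finite.mem_toFinset hfin).1 hp).1.2.1.le) c.r_le (fun x h0 hx => by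
      have hlr := c.l_lt_r
      have hl0 := c.l_nonneg
      by_cases ht : ∃ j, IsTall I (opt I) j ∧ PackedAt I σ j x
      · obtain ⟨j, hj, hp⟩ := ht
        refine .inl ⟨j, mem_rightTall.2 ⟨hj, (c.tall_side j hj).resolve_left fun h => ?_⟩, hp⟩
        linarith [hp.2]
      · push Not at ht
        obtain ⟨l', r', hg', h1, h2, -, -⟩ := exists_isGap I (opt I) σ (by linarith) hx ht
        refine .inr ⟨(l', r'), (Set.Finite.mem_toFinset hfin).2 ⟨hg', ?_⟩, h1, h2⟩
        by_contra! hcon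
        have := (hg.eq_of_lt hg' (by linarith) hcon).2
        linarith)
  linarith

end

end DSP

theorem mainTheorem11 {ι : Type*} [Fintype ι] (I : DSP.Instance ι) (ε lam : ℝ) (hε : 0 < ε)
    (hlam : lam ≤ min (ε / (3 * (5 + 4 * ε))) (1 / 60))
    (σopt : ι → ℝ) (hσopt : DSP.IsOptimal I σopt)
    (l r : ℝ) (hgap : DSP.IsGap I (DSP.opt I) σopt l r)
    (hwide : (1 / 2 - 3 * lam) * I.D ≤ r - l)
    (hleft : DSP.gapWidthLeft I (DSP.opt I) σopt l ≤ lam * I.D)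
    (hright : DSP.gapWidthRight I (DSP.opt I) σopt r ≤ lam * I.D) :
    ∃ σ : ι → ℝ, DSP.IsNeat I ε (DSP.opt I) σ := by
  classical
  have c := hgap.gapConfig hσopt
  have h1 := (hgap.sub_sum_le_gapWidthLeft hσopt).trans hleft
  have h2 := (hgap.sub_sum_le_gapWidthRight hσopt).trans hright
  obtain ⟨hlam1, hlam2⟩ := le_min_iff.1 hlam
  obtain ⟨pos, hpos, hsort⟩ := DSP.exists_tallPos I (DSP.opt I)
  obtain ⟨σ, hfeas, htall, hload⟩ : ∃ σ : ι → ℝ, (∀ i, 0 ≤ σ i ∧ σ i + I.w i ≤ I.D) ∧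
      (∀ i, (DSP.opt I : ℝ) / 2 < I.h i → σ i = pos i) ∧
      ∀ τ, ∀ S : Finset ι, (∀ i ∈ S, σ i ≤ τ ∧ τ < σ i + I.w i) →
        ∑ i ∈ S, (I.h i : ℝ) ≤ (3 / 2 + ε) * DSP.opt I := by
    rcases le_total (I.D - r) l with hlr | hlr
    · exact c.exists_packing hpos hε hlam1 hlam2 hwide hlr h1 h2
    -- The packing found for the reflected configuration is used without reflecting back: widths,
    -- heights and `pos` are unchanged, and the conclusion does not mention the old starting points.
    · refine c.mirror.exists_packing hpos hε hlam1 hlam2 (by linarith) (by linarith) ?_ ?_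
      · rw [DSP.GapConfig.leftTall_mirror]; exact h2
      · rw [DSP.GapConfig.rightTall_mirror]; linarith
  refine ⟨σ, fun i => ⟨(hfeas i).1, by linarith [(hfeas i).2]⟩, ?_, hsort σ htall⟩
  obtain ⟨t, -, ht⟩ := (DSP.height_isGreatest I σ).1
  rw [← ht, DSP.heightAt, Nat.cast_sum]
  exact hload t _ fun i hi => (Finset.mem_filter.1 hi).2
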